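/- \textbf{Setting.} Consider the classical risk model with premium rate $1$, Poisson claim arrivals of rate $\lambda>0$ and i.i.d. claim sizes independent of the arrivals. Let $B$ be a phase-type claim size and $C\ge 0$ another claim size, with finite means and $\mathbb E B>0$, and put $\delta=\lambda\,\mathbb E B$ and $\theta=\lambda\,\mathbb E C$; assume $\delta<1$. For $\varepsilon\in[0,1]$ let $\psi_\varepsilon(u)=P(M_\varepsilon>u)$ be the ruin probability with initial capital $u\ge 0$ when a claim is distributed as $B$ with probability $1-\varepsilon$ and as $C$ with probability $\varepsilon$, where $M_\varepsilon$ is the supremum over $t\ge0$ of the claim surplus process (total claims up to time $t$ minus $t$). Let $M^\bullet_\varepsilon$ be the supremum of the claim surplus process in the model in which a claim is distributed as $B$ with probability $1-\varepsilon$ and equals $0$ with probability $\varepsilon$, and let $\psi^\bullet_\varepsilon(u)=P(M^\bullet_\varepsilon>u)$. Let $M^\bullet_{\varepsilon,0},M^\bullet_{\varepsilon,1},M^\bullet_{\varepsilon,2}$ be copies of $M^\bullet_\varepsilon$ and $C^e_1,C^e_2$ copies of $C^e$, all independent, where $C^e$ has the stationary excess distribution $P(C^e\le u)=\frac1{\mathbb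 E C}\int_0^u P(C>t)\,dt$. The corrected discard approximation of $\psi_\varepsilon(u)$ is $$\hat\psi_{d,\varepsilon}(u)=\psi^\bullet_\varepsilon(u)+\frac{\varepsilon\theta}{1-\delta+\varepsilon\delta}\Big(P(M^\bullet_{\varepsilon,0}+M^\bullet_{\varepsilon,1}+C^e_1>u)-P(M^\bullet_{\varepsilon,0}>u)\Big),$$ and its relative error is $R_{d,\varepsilon}(u)=1-\hat\psi_{d,\varepsilon}(u)/\psi_\varepsilon(u)$. \textbf{Theorem.} Assume that the distribution $F$ of $C^e$ is subexponential, i.e. $\lim_{u\to\infty}\frac{1-F^{*n}(u)}{1-F(u)}=n$ for all $n=1,2,\dots$, where $F^{*n}$ is the $n$-fold convolution of $F$. Then there exist $\eta>0$ and a finite constant $K$ (independent of $\varepsilon$ and $u$) such that for all $\varepsilon\in[0,1]$ with $\varepsilon<\eta$ and all $u\ge0$, $$R_{d,\varepsilon}(u)\le\frac{\varepsilon\theta}{1-\delta+\varepsilon\delta}\,H_\varepsilon(u)+\varepsilon^2K,\qquad H_\varepsilon(u)=\frac{P(M^\bullet_{\varepsilon,0}+M^\bullet_{\varepsilon,1}+M^\bullet_{\varepsilon,2}+C^e_1+C^e_2>u)}{P(M^\bullet_{\varepsilon,0}+M^\bullet_{\varepsilon,1}+C^e_1>u)}-1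 .$$ -/

import Mathlib

open MeasureTheory ProbabilityTheory Filter Topology
open scoped NNReal ENNReal

namespace RiskModel

noncomputable section

/-! ### Distributions on the real line -/

/-- `n`-fold convolution of `μ`: the law of the sum of `n` independent variables with law `μ`
(the unit mass at `0` for `n = 0`). -/
def convPow (μ : Measure ℝ) : ℕ → Measure ℝ
  | 0 => Measure.dirac 0
  | n + 1 => Measure.conv (convPow μ n) μ

/-- The stationary excess distribution of a distribution `μ` on `[0, ∞)` with finite mean `m`:
it has density `t ↦ μ (t, ∞) / m` on `(0, ∞)`. -/
def stationaryExcess (μ : Measure ℝ) : Measure ℝ :=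
  (volume.restrict (Set.Ioi 0)).withDensity
    fun t => ENNReal.ofReal (μ.real (Set.Ioi t) / ∫ x, x ∂μ)

/-- The class of subexponential distributions: probability distributions concentrated on `[0, ∞)`
such that the tail of the `n`-fold convolution is asymptotically `n` times the tail, for every
`n ≥ 1`. -/
structure IsSubexponential (μ : Measure ℝ) : Prop where
  isProbabilityMeasure : IsProbabilityMeasure μ
  concentrated : μ (Set.Iio 0) = 0
  tendsto_ratio : ∀ n : ℕ, 1 ≤ n →
    Tendsto (fun u : ℝ => (convPow μ n).real (Set.Ioi u) / μ.real (Set.Ioi u)) atTop (𝓝 (n : ℝ))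

/-- Phase-type distributions: the law of the time to absorption of a finite continuous-time
Markov chain with transient states `Fin m` and one absorbing state, initial (sub-)probability
vector `α` on the transient states (the missing mass being an atom at `0`) and nonsingular
sub-intensity matrix `T`; nonsingularity means that absorption is certain. -/
structure IsPhaseType (μ : Measure ℝ) : Prop where
  isProbabilityMeasure : IsProbabilityMeasure μ
  concentrated : μ (Set.Iio 0) = 0
  exists_representation : ∃ (m : ℕ) (α : Fin m → ℝ) (T : Matrix (Fin m) (Fin m) ℝ),
    (∀ i, 0 ≤ α i) ∧ (∑ i, α i ≤ 1) ∧
    (∀ i j, i ≠ j → 0 ≤ T i j) ∧ (∀ i, ∑ j, T i j ≤ 0) ∧ IsUnit T.det ∧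
    ∀ x : ℝ, 0 ≤ x →
      μ.real (Set.Ioi x) = dotProduct α (Matrix.mulVec (NormedSpace.exp (x • T)) 1)

/-! ### The classical (Cramér–Lundberg) risk model

A sample point `ω : ℕ → ℝ × ℝ` lists, for each claim, the time elapsed since the previous claim
and the size of the claim. The premium rate is `1`. -/

/-- Inter-arrival times are exponential with rate `lam` (so claims arrive according to a Poisson
process of rate `lam`), claim sizes have law `G`, and all of them are independent. -/
def claimsMeasure (lam : ℝ) (G : Measure ℝ) : Measure (ℕ → ℝ × ℝ) :=
  Measure.infinitePi fun _ => (expMeasure lam).prod G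

/-- The arrival time of the claim with index `n` (indices start at `0`). -/
def arrivalTime (ω : ℕ → ℝ × ℝ) (n : ℕ) : ℝ := ∑ i ∈ Finset.range (n + 1), (ω i).1

/-- The number of claims that arrive in `[0, t]`. -/
def claimCount (ω : ℕ → ℝ × ℝ) (t : ℝ≥0) : ℕ := Set.ncard {n : ℕ | arrivalTime ω n ≤ t}

/-- The claim surplus process: aggregate claims up to time `t` minus the premium income `t`. -/
def claimSurplus (ω : ℕ → ℝ × ℝ) (t : ℝ≥0) : ℝ :=
  (∑ i ∈ Finset.range (claimCount ω t), (ω i).2) - (t : ℝ)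

/-- The supremum over `[0, ∞)` of the claim surplus process, possibly infinite. -/
def surplusSup (ω : ℕ → ℝ × ℝ) : EReal := ⨆ t : ℝ≥0, (claimSurplus ω t : EReal)

/-- The probability of ultimate ruin with initial capital `u`. -/
def ruinProb (lam : ℝ) (G : Measure ℝ) (u : ℝ) : ℝ :=
  (claimsMeasure lam G).real {ω | (u : EReal) < surplusSup ω}

/-- The law of the supremum of the claim surplus process, as a law on `ℝ`. It is used only when
the mean claim amount per unit time is less than `1`, where the supremum is almost surely finite. -/
def supLaw (lam : ℝ) (G : Measure ℝ) : Measure ℝ :=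
  (claimsMeasure lam G).map fun ω => (surplusSup ω).toReal

/-! ### The mixture model and the corrected discard approximation -/

/-- Claim size distribution: law `B` with probability `1 - ε` and law `C` with probability `ε`. -/
def mixtureClaim (B C : Measure ℝ) (ε : ℝ) : Measure ℝ :=
  ENNReal.ofReal (1 - ε) • B + ENNReal.ofReal ε • C

/-- Claim size distribution after the `C`-claims have been discarded, i.e. replaced by `0`. -/
def discardClaim (B : Measure ℝ) (ε : ℝ) : Measure ℝ :=
  mixtureClaim B (Measure.dirac 0) ε

/-- `P(M₀ + M₁ + ⋯ + Mₙ + C₁ᵉ + ⋯ + Cₙᵉ > u)`, where all variables are independent, each `Mᵢ` is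
distributed as the supremum of the claim surplus process of the model in which the `C`-claims are
discarded, and each `Cᵢᵉ` has the stationary excess distribution of `C`. -/
def discardTail (lam : ℝ) (B C : Measure ℝ) (ε : ℝ) (n : ℕ) (u : ℝ) : ℝ :=
  (Measure.conv (convPow (supLaw lam (discardClaim B ε)) (n + 1))
    (convPow (stationaryExcess C) n)).real (Set.Ioi u)

/-- The coefficient `εθ / (1 - δ + εδ)`, where `δ = lam * E[B]` and `θ = lam * E[C]`. -/
def discardCoeff (lam : ℝ) (B C : Measure ℝ) (ε : ℝ) : ℝ :=
  ε * (lam * ∫ x, x ∂C) / (1 - lam * (∫ x, x ∂B) + ε * (lam * ∫ x, x ∂B))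

/-- The corrected discard approximation of the ruin probability. -/
def correctedDiscard (lam : ℝ) (B C : Measure ℝ) (ε u : ℝ) : ℝ :=
  ruinProb lam (discardClaim B ε) u +
    discardCoeff lam B C ε *
      (discardTail lam B C ε 1 u - ruinProb lam (discardClaim B ε) u)

/-- The relative error of the corrected discard approximation. -/
def discardRelError (lam : ℝ) (B C : Measure ℝ) (ε u : ℝ) : ℝ :=
  1 - correctedDiscard lam B C ε u / ruinProb lam (mixtureClaim B C ε) u

/-- `P(M₀ + M₁ + M₂ + C₁ᵉ + C₂ᵉ > u) / P(M₀ + M₁ + C₁ᵉ > u) - 1`. -/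
def discardH (lam : ℝ) (B C : Measure ℝ) (ε u : ℝ) : ℝ :=
  discardTail lam B C ε 2 u / discardTail lam B C ε 1 u - 1

end

end RiskModel

/-!
The proof compares two renewal equations. The supremum `M` of the claim surplus process is almost
surely the all-time maximum of the random walk with steps "claim size minus inter-arrival time",
so Lindley's recursion gives `M = (Y + M - T)⁺` in law, with a claim `Y` and an exponential time `T`
independent of `M` (`supLaw_eq_map_max`). Integrating out `T` in the characteristic function turns
this into an algebraic relation between the characteristic functions of `M` and `Y`
(`exists_charFun_supLaw_mul`). Since `i t` times the characteristic function of the integrated tail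
of `Y` is `E e ^ (i t Y) - 1` (`integral_real_Ioi_mul_cexp`), the relation is a
Pollaczek–Khinchine renewal equation. For the law `ν` of the supremum without the `C`-claims it
reads `ν = (1 - r) δ₀ + r ν ∗ Bᵉ` with `r = (1 - ε) δ` (`supLaw_discardClaim_renewal`).
Eliminating `Bᵉ` between this and the equation for the law `μ` of the full model leaves
`μ = (1 - q) ν + q μ ∗ κ`, where `κ = Cᵉ ∗ ν` and `q` is the discard coefficient
(`supLaw_mixtureClaim_renewal`).

Write `Tₙ` for the tail of `ν ∗ κⁿ` at `u`, which is `discardTail n`, and `Wₙ` for that of `μ ∗ κⁿ`.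
Unfolding the equation three times gives `ψ - ψ̂ = q² (T₂ - T₁) + q³ (W₃ - T₂)`, while `ψ ≥ q T₁`.
Dividing, the first term yields `q H`, and the second is at most `q² W₃ / T₁` (`relError_le`). It
remains to bound `W₃ / T₁` uniformly in `ε` and `u`; as `T₁` is at least the tail `F̄` of the law
`F` of `Cᵉ`, it is enough to bound `W₃` by a multiple of `F̄`.

* Convolution preserves domination by multiples of `F̄`, because the tail of `F ∗ F` is at most a
  multiple of `F̄` (`conv_Ioi_le_of_le`); subexponentiality is used here and in the next point.
* Phase-type tails decay exponentially (`IsPhaseType.exists_Ioi_le_exp`), so by its renewal equation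
  `ν` has an exponential tail bound uniform in `ε`; subexponential tails are heavier than
  exponentials (`IsSubexponential.exists_exp_le`), so the tail of `ν` is dominated by `F̄`.
* For small `ε`, iterating the equation for `μ` gives a convergent geometric series of multiples of
  `F̄` (`renewal_Ioi_le`), so the tail of `μ` is dominated by `F̄`, and hence that of `μ ∗ κ³` is.

The division by `ψ` needs `ψ > 0`. When `ε = 0` the bound `ψ ≥ q T₁` does not give this, and it
follows from unbounded claim totals instead (`renewal_Ioi_pos`).
-/

namespace RiskModel

/-! ### Tails of convolutions -/

instance isProbabilityMeasure_convPow (μ : Measure ℝ) [IsProbabilityMeasure μ] (n : ℕ) :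
    IsProbabilityMeasure (convPow μ n) := by
  induction n with
  | zero => unfold convPow; infer_instance
  | succ n ih => unfold convPow; infer_instance

lemma convPow_one (μ : Measure ℝ) [SFinite μ] : convPow μ 1 = μ := by
  simp [convPow, Measure.dirac_zero_conv]

lemma conv_apply_Ioi (μ ν : Measure ℝ) [SFinite μ] [SFinite ν] (x : ℝ) :
    (μ.conv ν) (Set.Ioi x) = ∫⁻ y, μ (Set.Ioi (x - y)) ∂ν := by
  rw [Measure.conv_comm, ← lintegral_indicator_one measurableSet_Ioi,
    Measure.lintegral_conv (measurable_one.indicator measurableSet_Ioi)]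
  refine lintegral_congr fun y => ?_
  rw [← lintegral_indicator_one measurableSet_Ioi]
  refine lintegral_congr fun z => ?_
  simp only [Set.indicator, Set.mem_Ioi, sub_lt_iff_lt_add', Pi.one_apply]

lemma conv_Ioi_le_mul {μ μ' ν : Measure ℝ} [SFinite μ] [SFinite μ'] [SFinite ν] {a : ℝ≥0∞}
    (h : ∀ x, μ (Set.Ioi x) ≤ a * μ' (Set.Ioi x)) (x : ℝ) :
    (μ.conv ν) (Set.Ioi x) ≤ a * (μ'.conv ν) (Set.Ioi x) := by
  rw [conv_apply_Ioi, conv_apply_Ioi, ← lintegral_const_mul]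
  · exact lintegral_mono fun y => h _
  · exact (Antitone.measurable fun a b hab => measure_mono (Set.Ioi_subset_Ioi hab)).comp
      (measurable_const.sub measurable_id)

/-- Tails dominated by multiples of the tail of `F` have a convolution with a dominated tail, once
this holds for `F ∗ F`. -/
lemma conv_Ioi_le_of_le {F μ ν : Measure ℝ} [SFinite F] [SFinite μ] [SFinite ν] {S a b : ℝ≥0∞}
    (hS : ∀ x, (F.conv F) (Set.Ioi x) ≤ S * F (Set.Ioi x))
    (hμ : ∀ x, μ (Set.Ioi x) ≤ a * F (Set.Ioi x)) (hν : ∀ x, ν (Set.Ioi x) ≤ b * F (Set.Ioi x))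
    (x : ℝ) : (μ.conv ν) (Set.Ioi x) ≤ a * b * S * F (Set.Ioi x) := by
  refine (conv_Ioi_le_mul hμ x).trans ?_
  rw [Measure.conv_comm, mul_assoc, mul_assoc]
  gcongr
  refine (conv_Ioi_le_mul hν x).trans ?_
  gcongr
  exact hS x

lemma ae_nonneg_of_Iio_zero {μ : Measure ℝ} (hμ : μ (Set.Iio 0) = 0) : ∀ᵐ y ∂μ, 0 ≤ y := by
  filter_upwards [measure_eq_zero_iff_ae_notMem.1 hμ] with y hy
  simpa using hy

lemma Ioi_le_conv {μ ν : Measure ℝ} [SFinite μ] [IsProbabilityMeasure ν] (hν : ν (Set.Iio 0) = 0)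
    (x : ℝ) : μ (Set.Ioi x) ≤ (μ.conv ν) (Set.Ioi x) := by
  rw [conv_apply_Ioi]
  calc μ (Set.Ioi x) = ∫⁻ _, μ (Set.Ioi x) ∂ν := by simp
    _ ≤ _ := by
      refine lintegral_mono_ae ?_
      filter_upwards [ae_nonneg_of_Iio_zero hν] with y hy
      exact measure_mono (Set.Ioi_subset_Ioi (by linarith))

lemma conv_Iio_zero {μ ν : Measure ℝ} [SFinite μ] [SFinite ν] (hμ : μ (Set.Iio 0) = 0)
    (hν : ν (Set.Iio 0) = 0) : (μ.conv ν) (Set.Iio 0) = 0 := by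
  rw [Measure.conv, Measure.map_apply (by fun_prop) measurableSet_Iio]
  have h1 : ∀ᵐ z ∂(μ.prod ν), 0 ≤ z.1 :=
    Measure.quasiMeasurePreserving_fst.ae (ae_nonneg_of_Iio_zero hμ)
  have h2 : ∀ᵐ z ∂(μ.prod ν), 0 ≤ z.2 :=
    Measure.quasiMeasurePreserving_snd.ae (ae_nonneg_of_Iio_zero hν)
  refine measure_eq_zero_iff_ae_notMem.2 ?_
  filter_upwards [h1, h2] with z hz1 hz2
  simp only [Set.mem_preimage, Set.mem_Iio, not_lt]
  positivity

lemma measure_Ioi_of_neg {μ : Measure ℝ} [IsProbabilityMeasure μ] (hμ : μ (Set.Iio 0) = 0)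
    {x : ℝ} (hx : x < 0) : μ (Set.Ioi x) = 1 := by
  have h : μ (Set.Ioi x)ᶜ = 0 :=
    measure_mono_null (fun y hy => by simp at hy ⊢; linarith) hμ
  simpa using (prob_compl_eq_zero_iff measurableSet_Ioi).1 h

/-! ### Renewal equations -/

lemma renewal_conv_convPow {μ ν κ : Measure ℝ} [IsProbabilityMeasure μ] [IsProbabilityMeasure ν]
    [IsProbabilityMeasure κ] {a r : ℝ≥0∞} (h : μ = a • ν + r • μ.conv κ) (n : ℕ) :
    μ.conv (convPow κ n) = a • ν.conv (convPow κ n) + r • μ.conv (convPow κ (n + 1)) := by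
  conv_lhs => rw [h]
  rw [Measure.add_conv, Measure.conv_smul_left, Measure.conv_smul_left, Measure.conv_assoc,
    Measure.conv_comm κ]
  rfl

/-- A solution of the renewal equation `μ = a ν + r μ ∗ κ`, unfolded `N` times. -/
lemma renewal_Ioi_le_sum {μ ν κ : Measure ℝ} [IsProbabilityMeasure μ] [IsProbabilityMeasure ν]
    [IsProbabilityMeasure κ] {a r : ℝ≥0∞} (ha : a ≤ 1) (h : μ = a • ν + r • μ.conv κ)
    (x : ℝ) (N : ℕ) :
    μ (Set.Ioi x) ≤ ∑ n ∈ Finset.range N, r ^ n * (ν.conv (convPow κ n)) (Set.Ioi x) +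
      r ^ N * (μ.conv (convPow κ N)) (Set.Ioi x) := by
  induction N with
  | zero => simp [convPow]
  | succ N ih =>
    refine ih.trans ?_
    rw [Finset.sum_range_succ, add_assoc]
    gcongr
    rw [renewal_conv_convPow h N, Measure.add_apply, Measure.smul_apply, Measure.smul_apply,
      smul_eq_mul, smul_eq_mul, mul_add, pow_succ, mul_assoc]
    gcongr
    exact mul_le_of_le_one_left zero_le ha

/-- Geometric bounds on the tails of `ν ∗ κⁿ` sum to a bound on the tail of a solution of the
renewal equation, which is of use when `r c < 1`; the remainder vanishes because `r < 1`. -/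
lemma renewal_Ioi_le {μ ν κ : Measure ℝ} [IsProbabilityMeasure μ] [IsProbabilityMeasure ν]
    [IsProbabilityMeasure κ] {a r A c : ℝ≥0∞} {g : ℝ≥0∞} (ha : a ≤ 1) (hr : r < 1)
    (h : μ = a • ν + r • μ.conv κ) {x : ℝ}
    (hg : ∀ n, (ν.conv (convPow κ n)) (Set.Ioi x) ≤ A * c ^ n * g) :
    μ (Set.Ioi x) ≤ A * (1 - r * c)⁻¹ * g := by
  have key : ∀ N : ℕ, μ (Set.Ioi x) ≤ A * (1 - r * c)⁻¹ * g + r ^ N := by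
    intro N
    refine (renewal_Ioi_le_sum ha h x N).trans ?_
    gcongr
    · calc ∑ n ∈ Finset.range N, r ^ n * (ν.conv (convPow κ n)) (Set.Ioi x)
          ≤ ∑ n ∈ Finset.range N, A * g * (r * c) ^ n := by
            refine Finset.sum_le_sum fun n _ => ?_
            calc _ ≤ r ^ n * (A * c ^ n * g) := by gcongr; exact hg n
              _ = _ := by rw [mul_pow]; ring
        _ ≤ ∑' n, A * g * (r * c) ^ n := ENNReal.sum_le_tsum _
        _ = _ := by rw [ENNReal.tsum_mul_left, ENNReal.tsum_geometric]; ring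
    · exact mul_le_of_le_one_right zero_le prob_le_one
  have hlim : Tendsto (fun N : ℕ => A * (1 - r * c)⁻¹ * g + r ^ N) atTop
      (𝓝 (A * (1 - r * c)⁻¹ * g + 0)) :=
    tendsto_const_nhds.add (ENNReal.tendsto_pow_atTop_nhds_zero_of_lt_one hr)
  simpa using ge_of_tendsto' hlim key

/-! ### Subexponential distributions -/

variable {F : Measure ℝ}

lemma IsSubexponential.real_Ioi_pos (hF : IsSubexponential F) (x : ℝ) : 0 < F.real (Set.Ioi x) := by
  have := hF.isProbabilityMeasure
  by_contra hx
  have h0 : F.real (Set.Ioi x) = 0 := le_antisymm (not_lt.1 hx) measureReal_nonneg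
  have h1 := hF.tendsto_ratio 1 le_rfl
  have h2 : Tendsto (fun u : ℝ => (convPow F 1).real (Set.Ioi u) / F.real (Set.Ioi u)) atTop
      (𝓝 (0 : ℝ)) := by
    refine tendsto_const_nhds.congr' ?_
    filter_upwards [eventually_ge_atTop x] with u hu
    have : F.real (Set.Ioi u) = 0 :=
      le_antisymm (h0 ▸ measureReal_mono (Set.Ioi_subset_Ioi hu)) measureReal_nonneg
    rw [this, div_zero]
  have := tendsto_nhds_unique h1 h2
  simp at this

lemma IsSubexponential.tendsto_ratio_two (hF : IsSubexponential F) :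
    Tendsto (fun u : ℝ => (F.conv F).real (Set.Ioi u) / F.real (Set.Ioi u)) atTop (𝓝 2) := by
  have := hF.isProbabilityMeasure
  have h := hF.tendsto_ratio 2 (by norm_num)
  rw [show convPow F 2 = F.conv F by rw [← convPow_one F]; simp [convPow]] at h
  simpa using h

lemma IsSubexponential.exists_conv_Ioi_le (hF : IsSubexponential F) :
    ∃ S : ℝ≥0∞, S ≠ ∞ ∧ 1 ≤ S ∧ ∀ x, (F.conv F) (Set.Ioi x) ≤ S * F (Set.Ioi x) := by
  have := hF.isProbabilityMeasure
  obtain ⟨x₀, hx₀⟩ := eventually_atTop.1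
    (hF.tendsto_ratio_two.eventually_le_const (show (2 : ℝ) < 3 by norm_num))
  have hpos : F (Set.Ioi x₀) ≠ 0 := fun h => by
    have := hF.real_Ioi_pos x₀
    simp [Measure.real, h] at this
  refine ⟨max 3 (F (Set.Ioi x₀))⁻¹, ?_, le_max_of_le_left (by norm_num), fun x => ?_⟩
  · exact (max_lt (by simp) (by simpa [ENNReal.inv_lt_top] using pos_iff_ne_zero.2 hpos)).ne
  rcases le_total x₀ x with hx | hx
  · have h3 := hx₀ x hx
    rw [div_le_iff₀ (hF.real_Ioi_pos x)] at h3
    calc (F.conv F) (Set.Ioi x) = ENNReal.ofReal ((F.conv F).real (Set.Ioi x)) := by simp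
      _ ≤ ENNReal.ofReal (3 * F.real (Set.Ioi x)) := ENNReal.ofReal_le_ofReal h3
      _ = 3 * F (Set.Ioi x) := by rw [ENNReal.ofReal_mul (by norm_num)]; simp
      _ ≤ _ := by gcongr; exact le_max_left _ _
  · calc (F.conv F) (Set.Ioi x) ≤ 1 := prob_le_one
      _ = (F (Set.Ioi x₀))⁻¹ * F (Set.Ioi x₀) := (ENNReal.inv_mul_cancel hpos (by simp)).symm
      _ ≤ _ := by
        gcongr
        exact le_max_right _ _

/-- Splitting `X₁ + X₂ > x` according to the value of `X₂` in `[0, 1]`, `(1, x]`, `(x, ∞)`. -/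
lemma conv_self_Ioi_ge [IsProbabilityMeasure F] (hF : F (Set.Iio 0) = 0) {x : ℝ} (hx : 1 ≤ x) :
    F.real (Set.Ioi x) + F.real (Set.Ioi x) * (1 - F.real (Set.Ioi 1)) +
      F.real (Set.Ioi (x - 1)) * (F.real (Set.Ioi 1) - F.real (Set.Ioi x)) ≤
      (F.conv F).real (Set.Ioi x) := by
  have hIcc : F.real (Set.Icc 0 1) = 1 - F.real (Set.Ioi 1) := by
    have h : Set.Ici (0 : ℝ) \ Set.Icc 0 1 = Set.Ioi 1 := by
      ext y; simp; constructor
      · rintro ⟨h1, h2⟩; exact h2 h1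
      · intro h; exact ⟨by linarith, fun _ => h⟩
    have h1 : F.real (Set.Ici 0) = 1 := by
      rw [← Set.compl_Iio, probReal_compl_eq_one_sub measurableSet_Iio]; simp [Measure.real, hF]
    rw [← h, measureReal_sdiff Set.Icc_subset_Ici_self measurableSet_Icc, h1]; ring
  have hIoc : F.real (Set.Ioc 1 x) = F.real (Set.Ioi 1) - F.real (Set.Ioi x) := by
    rw [← Set.Ioi_sdiff_Ioi, measureReal_sdiff (Set.Ioi_subset_Ioi hx) measurableSet_Ioi]
  rw [← hIcc, ← hIoc]
  have hlow : ∫⁻ y, (Set.indicator (Set.Ioi x) (fun _ => (1 : ℝ≥0∞)) y +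
      Set.indicator (Set.Icc 0 1) (fun _ => F (Set.Ioi x)) y +
      Set.indicator (Set.Ioc 1 x) (fun _ => F (Set.Ioi (x - 1))) y) ∂F ≤
      (F.conv F) (Set.Ioi x) := by
    rw [conv_apply_Ioi]
    refine lintegral_mono fun y => ?_
    by_cases h1 : x < y
    · have : ¬ (0 ≤ y ∧ y ≤ 1) := fun h => by linarith [h.2]
      have h2 : ¬ (1 < y ∧ y ≤ x) := fun h => by linarith [h.2]
      simp [Set.indicator, h1, this, h2, measure_Ioi_of_neg hF (show x - y < 0 by linarith)]
    · by_cases h2 : 1 < y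
      · have : ¬ (0 ≤ y ∧ y ≤ 1) := fun h => by linarith [h.2]
        simp only [Set.indicator, Set.mem_Ioi, h1, Set.mem_Icc, this, Set.mem_Ioc, h2,
          not_lt.1 h1, and_self, if_true, if_false, zero_add]
        exact measure_mono (Set.Ioi_subset_Ioi (by linarith))
      · by_cases h3 : 0 ≤ y
        · simp only [Set.indicator, Set.mem_Ioi, h1, Set.mem_Icc, h3, not_lt.1 h2, Set.mem_Ioc, h2,
            and_self, false_and, if_true, if_false, zero_add, add_zero]
          exact measure_mono (Set.Ioi_subset_Ioi (by linarith))
        · simp [Set.indicator, h1, h2, h3]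
  rw [lintegral_add_right _ (measurable_const.indicator measurableSet_Ioc),
    lintegral_add_right _ (measurable_const.indicator measurableSet_Icc),
    lintegral_indicator_const measurableSet_Ioi, lintegral_indicator_const measurableSet_Icc,
    lintegral_indicator_const measurableSet_Ioc, one_mul] at hlow
  have h := ENNReal.toReal_mono (measure_ne_top _ _) hlow
  rw [ENNReal.toReal_add (by finiteness) (by finiteness),
    ENNReal.toReal_add (by finiteness) (by finiteness), ENNReal.toReal_mul, ENNReal.toReal_mul] at h
  exact h

/-- The ratio of the tails at `x - 1` and `x` tends to `1`: by the splitting above its upper limit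
is at most `(1 - F [0, 1]) / F (1, ∞) = 1`. -/
lemma IsSubexponential.eventually_le_exp_mul (hF : IsSubexponential F) {c : ℝ} (hc : 0 < c) :
    ∀ᶠ x in atTop, F.real (Set.Ioi (x - 1)) ≤ Real.exp c * F.real (Set.Ioi x) := by
  have := hF.isProbabilityMeasure
  have h1 := hF.real_Ioi_pos 1
  have htail : Tendsto (fun x => F.real (Set.Ioi x)) atTop (𝓝 0) := by
    have h := (tendsto_const_nhds (x := (1 : ℝ))).sub (tendsto_cdf_atTop F)
    rw [sub_self] at h
    refine h.congr fun x => ?_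
    rw [cdf_eq_real, ← Set.compl_Iic, probReal_compl_eq_one_sub measurableSet_Iic]
  have hlim : Tendsto (fun x => ((F.conv F).real (Set.Ioi x) / F.real (Set.Ioi x) - 1 -
      (1 - F.real (Set.Ioi 1))) / (F.real (Set.Ioi 1) - F.real (Set.Ioi x))) atTop
      (𝓝 ((2 - 1 - (1 - F.real (Set.Ioi 1))) / (F.real (Set.Ioi 1) - 0))) :=
    ((hF.tendsto_ratio_two.sub_const 1).sub_const _).div (tendsto_const_nhds.sub htail)
      (by simpa using h1.ne')
  rw [show (2 - 1 - (1 - F.real (Set.Ioi 1))) / (F.real (Set.Ioi 1) - 0) = 1 by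
    rw [div_eq_one_iff_eq (by simpa using h1.ne')]; ring] at hlim
  filter_upwards [hlim.eventually_le_const (Real.one_lt_exp_iff.2 hc),
    htail.eventually_lt_const h1, eventually_ge_atTop 1] with x hx hx1 hx2
  have hsplit := conv_self_Ioi_ge hF.concentrated hx2
  have hpos := hF.real_Ioi_pos x
  rw [div_le_iff₀ (by linarith)] at hx
  have h3 : (F.conv F).real (Set.Ioi x) / F.real (Set.Ioi x) * F.real (Set.Ioi x) =
    (F.conv F).real (Set.Ioi x) := by field_simp
  have h4 := mul_le_mul_of_nonneg_right hx hpos.le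
  rw [sub_mul, sub_mul, h3] at h4
  refine le_of_mul_le_mul_right ?_ (sub_pos.2 hx1)
  linarith

/-- Subexponential tails are heavier than every exponential tail. -/
lemma IsSubexponential.exists_exp_le (hF : IsSubexponential F) {c : ℝ} (hc : 0 < c) :
    ∃ A : ℝ, 0 < A ∧ ∀ x, 0 ≤ x → Real.exp (-c * x) ≤ A * F.real (Set.Ioi x) := by
  have := hF.isProbabilityMeasure
  obtain ⟨x₁, hx₁⟩ := eventually_atTop.1 (hF.eventually_le_exp_mul hc)
  set x₀ := max x₁ 0
  have hstep : ∀ n : ℕ, F.real (Set.Ioi x₀) ≤ Real.exp (c * n) * F.real (Set.Ioi (x₀ + n)) := by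
    intro n
    induction n with
    | zero => simp
    | succ n ih =>
      refine ih.trans ?_
      have h := hx₁ (x₀ + (n + 1)) (by
        have h1 : x₁ ≤ x₀ := le_max_left x₁ 0
        have h2 : (0 : ℝ) ≤ n := n.cast_nonneg
        linarith)
      rw [show x₀ + ((n : ℝ) + 1) - 1 = x₀ + n by ring] at h
      push_cast
      rw [mul_add, mul_one, Real.exp_add, mul_assoc]
      gcongr
  have hpos := hF.real_Ioi_pos x₀
  refine ⟨Real.exp c / F.real (Set.Ioi x₀), by positivity, fun x hx => ?_⟩
  have h1 : F.real (Set.Ioi (x₀ + ⌈x⌉₊)) ≤ F.real (Set.Ioi x) :=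
    measureReal_mono (Set.Ioi_subset_Ioi (by
      have h1 : 0 ≤ x₀ := le_max_right x₁ 0
      have h2 := Nat.le_ceil x
      linarith))
  have h2 : F.real (Set.Ioi x₀) ≤ Real.exp (c * (x + 1)) * F.real (Set.Ioi x) :=
    (hstep ⌈x⌉₊).trans (by
      gcongr
      exact (Nat.ceil_lt_add_one hx).le)
  rw [div_mul_eq_mul_div, le_div_iff₀ hpos]
  calc Real.exp (-c * x) * F.real (Set.Ioi x₀)
      ≤ Real.exp (-c * x) * (Real.exp (c * (x + 1)) * F.real (Set.Ioi x)) := by gcongr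
    _ = Real.exp c * F.real (Set.Ioi x) := by
      rw [← mul_assoc, ← Real.exp_add]; ring_nf

/-! ### Exponential decay of phase-type tails -/

section SubstochasticMatrix

variable {m : ℕ} {Q : Matrix (Fin m) (Fin m) ℝ}

lemma mulVec_mono_of_nonneg (hQ : ∀ i j, 0 ≤ Q i j) {v w : Fin m → ℝ} (h : v ≤ w) :
    Q.mulVec v ≤ Q.mulVec w :=
  fun i => by
    simp only [Matrix.mulVec, dotProduct]
    exact Finset.sum_le_sum fun j _ => mul_le_mul_of_nonneg_left (h j) (hQ i j)

lemma pow_nonneg_of_nonneg (hQ : ∀ i j, 0 ≤ Q i j) (k : ℕ) (i j : Fin m) : 0 ≤ (Q ^ k) i j := by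
  induction k generalizing i j with
  | zero => rw [pow_zero, Matrix.one_apply]; split_ifs <;> norm_num
  | succ k ih =>
    rw [pow_succ, Matrix.mul_apply]
    exact Finset.sum_nonneg fun l _ => mul_nonneg (ih i l) (hQ l j)

lemma pow_mulVec_one_antitone (hQ : ∀ i j, 0 ≤ Q i j) (hQ1 : Q.mulVec 1 ≤ 1) :
    Antitone fun k => (Q ^ k).mulVec (1 : Fin m → ℝ) := by
  refine antitone_nat_of_succ_le fun k => ?_
  rw [pow_succ, ← Matrix.mulVec_mulVec]
  exact mulVec_mono_of_nonneg (pow_nonneg_of_nonneg hQ k) hQ1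

/-- The limit of `Q ^ k 1` is a fixed vector of `Q`, hence zero when `1 - Q` is nonsingular. -/
lemma tendsto_pow_mulVec_one (hQ : ∀ i j, 0 ≤ Q i j) (hQ1 : Q.mulVec 1 ≤ 1)
    (hdet : (1 - Q).det ≠ 0) :
    Tendsto (fun k => (Q ^ k).mulVec (1 : Fin m → ℝ)) atTop (𝓝 0) := by
  have hanti := pow_mulVec_one_antitone hQ hQ1
  have hlim : Tendsto (fun k => (Q ^ k).mulVec (1 : Fin m → ℝ)) atTop
      (𝓝 fun i => ⨅ k, (Q ^ k).mulVec (1 : Fin m → ℝ) i) := by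
    refine tendsto_pi_nhds.2 fun i => tendsto_atTop_ciInf (fun a b h => hanti h i) ⟨0, ?_⟩
    rintro _ ⟨k, rfl⟩
    simp only [Matrix.mulVec, dotProduct]
    exact Finset.sum_nonneg fun j _ => mul_nonneg (pow_nonneg_of_nonneg hQ k i j) zero_le_one
  set v : Fin m → ℝ := fun i => ⨅ k, (Q ^ k).mulVec (1 : Fin m → ℝ) i
  have hfix : Q.mulVec v = v := by
    refine tendsto_nhds_unique
      ((Continuous.tendsto (f := fun w => Q.mulVec w) (by fun_prop) v).comp hlim) ?_
    refine ((tendsto_add_atTop_iff_nat 1).2 hlim).congr fun k => ?_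
    simp [pow_succ', Matrix.mulVec_mulVec]
  have hv : v = 0 := Matrix.eq_zero_of_mulVec_eq_zero hdet (by
    rw [Matrix.sub_mulVec, Matrix.one_mulVec, hfix, sub_self])
  rwa [hv] at hlim

/-- The decay of `Q ^ k 1` to `0` is geometric: once `Q ^ k₀ 1 ≤ 1 / 2`, every further `k₀` steps
halve the vector. -/
lemma exists_pow_mulVec_one_le (hQ : ∀ i j, 0 ≤ Q i j) (hQ1 : Q.mulVec 1 ≤ 1)
    (hdet : (1 - Q).det ≠ 0) :
    ∃ r : ℝ, 0 ≤ r ∧ r < 1 ∧ ∀ k i, (Q ^ k).mulVec (1 : Fin m → ℝ) i ≤ 2 * r ^ k := by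
  have hanti := pow_mulVec_one_antitone hQ hQ1
  obtain ⟨k₀, hk₀, hk₀pos⟩ : ∃ k₀, (∀ i, (Q ^ k₀).mulVec (1 : Fin m → ℝ) i ≤ 1 / 2) ∧ 0 < k₀ := by
    have h := eventually_all.2 fun i =>
      ((tendsto_pi_nhds.1 (tendsto_pow_mulVec_one hQ hQ1 hdet)) i).eventually_le_const
        (show (0 : Fin m → ℝ) i < 1 / 2 by simp)
    exact (h.and (eventually_gt_atTop 0)).exists
  set r : ℝ := (1 / 2 : ℝ) ^ ((k₀ : ℝ)⁻¹)
  have hr0 : 0 ≤ r := by positivity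
  have hr1 : r < 1 := Real.rpow_lt_one (by norm_num) (by norm_num) (by positivity)
  have hrk : r ^ k₀ = 1 / 2 := Real.rpow_inv_natCast_pow (by norm_num) hk₀pos.ne'
  refine ⟨r, hr0, hr1, fun k => ?_⟩
  induction k using Nat.strong_induction_on with
  | _ k ih =>
    intro i
    rcases lt_or_ge k k₀ with hk | hk
    · have h1 : (Q ^ k).mulVec (1 : Fin m → ℝ) i ≤ 1 := by
        simpa using hanti (Nat.zero_le k) i
      have h2 : r ^ k₀ ≤ r ^ k := pow_le_pow_of_le_one hr0 hr1.le hk.le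
      linarith
    · have h1 : (Q ^ k).mulVec (1 : Fin m → ℝ) ≤
          (1 / 2 : ℝ) • (Q ^ (k - k₀)).mulVec (1 : Fin m → ℝ) := by
        conv_lhs => rw [← Nat.sub_add_cancel hk, pow_add, ← Matrix.mulVec_mulVec]
        rw [← Matrix.mulVec_smul]
        exact mulVec_mono_of_nonneg (pow_nonneg_of_nonneg hQ _) fun i => by simpa using hk₀ i
      have h2 := ih (k - k₀) (by omega) i
      have h3 := h1 i
      rw [Pi.smul_apply, smul_eq_mul] at h3
      calc _ ≤ 1 / 2 * (2 * r ^ (k - k₀)) := h3.trans (by gcongr)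
        _ = 2 * (r ^ (k - k₀) * r ^ k₀) := by rw [hrk]; ring
        _ = 2 * r ^ k := by rw [← pow_add, Nat.sub_add_cancel hk]

open scoped Matrix.Norms.Operator in
lemma hasSum_exp_dotProduct (α : Fin m → ℝ) (Q : Matrix (Fin m) (Fin m) ℝ) (a : ℝ) :
    HasSum (fun k : ℕ => Real.exp (-a) * (a ^ k / k.factorial * dotProduct α ((Q ^ k).mulVec 1)))
      (dotProduct α ((NormedSpace.exp (a • (Q - 1))).mulVec 1)) := by
  have h1 : NormedSpace.exp (a • (Q - 1)) = Real.exp (-a) • NormedSpace.exp (a • Q) := by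
    have h2 : a • (Q - 1) = algebraMap ℝ (Matrix (Fin m) (Fin m) ℝ) (-a) + a • Q := by
      rw [Algebra.algebraMap_eq_smul_one, smul_sub, neg_smul]; abel
    have h3 : NormedSpace.exp (algebraMap ℝ (Matrix (Fin m) (Fin m) ℝ) (-a)) =
        algebraMap ℝ (Matrix (Fin m) (Fin m) ℝ) (Real.exp (-a)) := by
      rw [Real.exp_eq_exp_ℝ]
      exact (NormedSpace.algebraMap_exp_comm (𝕂 := ℝ) (-a)).symm
    rw [h2, Matrix.exp_add_of_commute _ _ (Algebra.commute_algebraMap_left (-a) (a • Q)),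
      h3, ← Algebra.smul_def]
  let L : Matrix (Fin m) (Fin m) ℝ →+ ℝ :=
    { toFun := fun M => dotProduct α (M.mulVec 1)
      map_zero' := by simp
      map_add' := fun M N => by rw [Matrix.add_mulVec, dotProduct_add] }
  have hL : Continuous L := by
    change Continuous fun M : Matrix (Fin m) (Fin m) ℝ => dotProduct α (M.mulVec 1)
    simp only [dotProduct, Matrix.mulVec]
    fun_prop
  have h3 := ((NormedSpace.exp_series_hasSum_exp' (𝕂 := ℝ) (a • Q)).const_smul
    (Real.exp (-a))).map L hL
  rw [h1]
  convert! h3 using 2 with k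
  simp only [Function.comp_apply, L, AddMonoidHom.coe_mk, ZeroHom.coe_mk, smul_pow,
    Matrix.smul_mulVec, dotProduct_smul, smul_eq_mul]
  ring

end SubstochasticMatrix

/-- Phase-type tails decay exponentially. The proof is by uniformization: `Q = 1 + T / c` is
substochastic for large `c`, and `exp (x T) = e ^ (-c x) ∑ (c x) ^ k Q ^ k / k!`. -/
lemma IsPhaseType.exists_Ioi_le_exp {B : Measure ℝ} (hB : IsPhaseType B) :
    ∃ K s : ℝ, 0 < s ∧ ∀ x, 0 ≤ x → B.real (Set.Ioi x) ≤ K * Real.exp (-s * x) := by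
  obtain ⟨m, α, T, hα, hα1, hT, hTrow, hTdet, htail⟩ := hB.exists_representation
  obtain ⟨c, hc, hcT⟩ : ∃ c : ℝ, 0 < c ∧ ∀ i, -T i i ≤ c := by
    refine ⟨1 + ∑ i, |T i i|, by positivity, fun i => ?_⟩
    have := Finset.single_le_sum (fun j _ => abs_nonneg (T j j)) (Finset.mem_univ i)
    linarith [neg_le_abs (T i i)]
  set Q : Matrix (Fin m) (Fin m) ℝ := 1 + c⁻¹ • T with hQdef
  have hTQ : T = c • (Q - 1) := by
    rw [hQdef, add_sub_cancel_left, smul_smul, mul_inv_cancel₀ hc.ne', one_smul]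
  have hQ : ∀ i j, 0 ≤ Q i j := by
    intro i j
    rw [hQdef, Matrix.add_apply, Matrix.smul_apply, Matrix.one_apply, smul_eq_mul]
    split_ifs with h
    · subst h
      have : c⁻¹ * (-T i i) ≤ 1 := by rw [inv_mul_le_iff₀ hc]; simpa using hcT i
      linarith
    · have := hT i j h
      positivity
  have hQ1 : Q.mulVec 1 ≤ 1 := by
    intro i
    rw [hQdef, Matrix.add_mulVec, Matrix.one_mulVec, Matrix.smul_mulVec, Pi.add_apply,
      Pi.smul_apply, smul_eq_mul]
    have h1 : T.mulVec 1 i ≤ 0 := by simpa [Matrix.mulVec, dotProduct] using hTrow i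
    have := mul_nonpos_of_nonneg_of_nonpos (inv_nonneg.2 hc.le) h1
    linarith
  have hdet : (1 - Q).det ≠ 0 := by
    intro h
    apply hTdet.ne_zero
    rw [hTQ, ← neg_sub 1 Q, smul_neg, ← neg_smul, Matrix.det_smul, h, mul_zero]
  obtain ⟨r, hr0, hr1, hr⟩ := exists_pow_mulVec_one_le hQ hQ1 hdet
  refine ⟨2, c * (1 - r), mul_pos hc (by linarith), fun x hx => ?_⟩
  rw [htail x hx, hTQ, smul_smul]
  have hs := hasSum_exp_dotProduct α Q (x * c)
  have hs' : HasSum (fun k : ℕ => Real.exp (-(x * c)) * ((x * c) ^ k / k.factorial * (2 * r ^ k)))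
      (2 * Real.exp (-(c * (1 - r)) * x)) := by
    have h := (NormedSpace.expSeries_div_hasSum_exp (𝔸 := ℝ) (x * c * r)).mul_left
      (2 * Real.exp (-(x * c)))
    rw [← Real.exp_eq_exp_ℝ, mul_assoc 2, ← Real.exp_add] at h
    convert! h using 2
    · rw [mul_pow]; ring
    · ring_nf
  refine hasSum_le (fun k => ?_) hs hs'
  gcongr
  calc dotProduct α ((Q ^ k).mulVec 1) ≤ ∑ i, α i * (2 * r ^ k) :=
        Finset.sum_le_sum fun i _ => mul_le_mul_of_nonneg_left (hr k i) (hα i)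
    _ = (∑ i, α i) * (2 * r ^ k) := by rw [Finset.sum_mul]
    _ ≤ 2 * r ^ k := mul_le_of_le_one_left (by positivity) hα1

/-! ### The stationary excess distribution -/

lemma measurable_real_Ioi (G : Measure ℝ) [IsFiniteMeasure G] :
    Measurable fun x : ℝ => G.real (Set.Ioi x) :=
  Antitone.measurable fun _ _ hab => measureReal_mono (Set.Ioi_subset_Ioi hab)

lemma isProbabilityMeasure_stationaryExcess {G : Measure ℝ} [IsProbabilityMeasure G]
    (hG : G (Set.Iio 0) = 0) (hint : Integrable (fun x : ℝ => x) G) (hm : 0 < ∫ x, x ∂G) :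
    IsProbabilityMeasure (stationaryExcess G) := by
  refine ⟨?_⟩
  have h0 := ae_nonneg_of_Iio_zero hG
  have h1 : ∫⁻ t in Set.Ioi (0 : ℝ), G (Set.Ioi t) = ENNReal.ofReal (∫ x, x ∂G) := by
    rw [ofReal_integral_eq_lintegral_ofReal hint h0,
      lintegral_eq_lintegral_meas_lt G h0 aemeasurable_id']
    rfl
  rw [stationaryExcess, withDensity_apply _ MeasurableSet.univ, Measure.restrict_univ]
  have h2 : ∀ t : ℝ, ENNReal.ofReal (G.real (Set.Ioi t) / ∫ x, x ∂G) =
      (ENNReal.ofReal (∫ x, x ∂G))⁻¹ * G (Set.Ioi t) := fun t => by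
    rw [ENNReal.ofReal_div_of_pos hm, ofReal_measureReal, ENNReal.div_eq_inv_mul]
  simp_rw [h2]
  rw [lintegral_const_mul _ (Antitone.measurable fun _ _ hab =>
    measure_mono (Set.Ioi_subset_Ioi hab)), h1]
  exact ENNReal.inv_mul_cancel (by simpa using hm) (by simp)

/-- Integration by parts: `i t ∫₀^∞ G(x, ∞) e ^ (i t x) dx = E (e ^ (i t X) - 1)`. -/
lemma integral_real_Ioi_mul_cexp {G : Measure ℝ} [IsProbabilityMeasure G]
    (hG : G (Set.Iio 0) = 0) (hint : Integrable (fun x : ℝ => x) G) (t : ℝ) :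
    t * Complex.I * ∫ x in Set.Ioi (0 : ℝ), (G.real (Set.Ioi x) : ℂ) *
      Complex.exp (t * x * Complex.I) = charFun G t - 1 := by
  have h0 := ae_nonneg_of_Iio_zero hG
  rcases eq_or_ne t 0 with rfl | ht
  · simp
  have htI : (t : ℂ) * Complex.I ≠ 0 := by simp [ht]
  set f : ℝ → ℝ → ℂ := fun x y => (Set.Iio y).indicator
    (fun x : ℝ => Complex.exp (t * x * Complex.I)) x with hf
  have hnorm : ∀ x : ℝ, ‖Complex.exp (t * x * Complex.I)‖ = 1 := fun x => by
    exact_mod_cast Complex.norm_exp_ofReal_mul_I (t * x)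
  have hfm : Measurable (Function.uncurry f) := by
    have : Function.uncurry f = {z : ℝ × ℝ | z.1 < z.2}.indicator
        (fun z => Complex.exp (t * z.1 * Complex.I)) := by
      ext ⟨x, y⟩
      simp [f, Set.indicator]
    rw [this]
    exact Measurable.indicator (by fun_prop) (measurableSet_lt measurable_fst measurable_snd)
  have hI : ∀ y : ℝ, 0 ≤ y → ∀ g : ℝ → ℂ, ∫ x in Set.Ioi (0 : ℝ), (Set.Iio y).indicator g x =
      ∫ x in (0 : ℝ)..y, g x := fun y hy g => by
    rw [setIntegral_indicator measurableSet_Iio, Set.Ioi_inter_Iio,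
      intervalIntegral.integral_of_le hy, integral_Ioc_eq_integral_Ioo]
  have hint2 : Integrable (Function.uncurry f) ((volume.restrict (Set.Ioi 0)).prod G) := by
    rw [integrable_prod_iff' hfm.aestronglyMeasurable]
    constructor
    · refine ae_of_all _ fun y => ?_
      refine IntegrableOn.integrable_indicator ?_ measurableSet_Iio
      change Integrable _ ((volume.restrict (Set.Ioi 0)).restrict (Set.Iio y))
      rw [Measure.restrict_restrict measurableSet_Iio, Set.inter_comm, Set.Ioi_inter_Iio]
      change IntegrableOn _ _ _
      refine Measure.integrableOn_of_bounded (M := 1) (by simp) (by fun_prop) ?_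
      exact ae_of_all _ fun x => (hnorm x).le
    · refine hint.congr ?_
      filter_upwards [h0] with y hy
      have : ∀ x, ‖Function.uncurry f (x, y)‖ = (Set.Iio y).indicator (fun _ => (1 : ℝ)) x := by
        intro x
        simp only [f, Function.uncurry, Set.indicator]
        split_ifs
        · exact hnorm x
        · simp
      simp_rw [this]
      rw [setIntegral_indicator measurableSet_Iio, Set.Ioi_inter_Iio]
      simp [hy]
  have h1 : ∀ x : ℝ, (G.real (Set.Ioi x) : ℂ) * Complex.exp (t * x * Complex.I) =
      ∫ y, f x y ∂G := by
    intro x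
    have : ∀ y, f x y = (Set.Ioi x).indicator
        (fun _ => Complex.exp (t * x * Complex.I)) y := fun y => by
      simp [f, Set.indicator]
    simp_rw [this]
    rw [integral_indicator_const _ measurableSet_Ioi, Complex.real_smul]
  simp_rw [h1]
  rw [integral_integral_swap hint2, ← integral_const_mul]
  have h2 : ∀ᵐ y ∂G, t * Complex.I * ∫ x in Set.Ioi (0 : ℝ), f x y =
      Complex.exp (t * y * Complex.I) - 1 := by
    filter_upwards [h0] with y hy
    rw [hI y hy]
    have : ∀ x : ℝ, (t : ℂ) * x * Complex.I = (t * Complex.I) * x := fun x => by ring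
    simp_rw [this]
    rw [integral_exp_mul_complex htI, mul_div_cancel₀ _ htI]
    simp
  rw [integral_congr_ae h2, integral_sub, charFun_apply_real]
  · simp
  · refine Integrable.of_bound (C := 1) (by fun_prop) (ae_of_all _ fun x => (hnorm x).le)
  · exact integrable_const _

lemma charFun_stationaryExcess {G : Measure ℝ} [IsProbabilityMeasure G]
    (hG : G (Set.Iio 0) = 0) (hint : Integrable (fun x : ℝ => x) G) (hm : 0 < ∫ x, x ∂G) (t : ℝ) :
    t * Complex.I * ((∫ x, x ∂G : ℝ) * charFun (stationaryExcess G) t) = charFun G t - 1 := by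
  rw [← integral_real_Ioi_mul_cexp hG hint t, charFun_apply_real, stationaryExcess,
    integral_withDensity_eq_integral_toReal_smul
      ((measurable_real_Ioi G).div_const _).ennreal_ofReal (ae_of_all _ fun _ => by simp),
    ← integral_const_mul]
  congr 1
  refine integral_congr_ae (ae_of_all _ fun x => ?_)
  have hm' : ((∫ x, x ∂G : ℝ) : ℂ) ≠ 0 := by exact_mod_cast hm.ne'
  simp only
  rw [ENNReal.toReal_ofReal (by positivity), Complex.real_smul, Complex.ofReal_div]
  field_simp

/-! ### Exponential moments -/

lemma lintegral_exp_conv (μ ν : Measure ℝ) [SFinite μ] [SFinite ν] (s : ℝ) :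
    ∫⁻ x, ENNReal.ofReal (Real.exp (s * x)) ∂(μ.conv ν) =
      (∫⁻ x, ENNReal.ofReal (Real.exp (s * x)) ∂μ) *
        ∫⁻ x, ENNReal.ofReal (Real.exp (s * x)) ∂ν := by
  rw [Measure.lintegral_conv (by fun_prop)]
  simp_rw [mul_add, Real.exp_add, ENNReal.ofReal_mul (Real.exp_pos _).le]
  simp_rw [lintegral_const_mul' _ _ ENNReal.ofReal_ne_top]
  rw [lintegral_mul_const _ (by fun_prop)]

lemma lintegral_exp_convPow (μ : Measure ℝ) [IsProbabilityMeasure μ] (s : ℝ) (n : ℕ) :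
    ∫⁻ x, ENNReal.ofReal (Real.exp (s * x)) ∂(convPow μ n) =
      (∫⁻ x, ENNReal.ofReal (Real.exp (s * x)) ∂μ) ^ n := by
  induction n with
  | zero => simp [convPow]
  | succ n ih => rw [pow_succ, ← ih, convPow, lintegral_exp_conv]

/-- The Chernoff bound. -/
lemma measure_Ioi_le_exp_mul_lintegral (μ : Measure ℝ) {s : ℝ} (hs : 0 ≤ s) (x : ℝ) :
    μ (Set.Ioi x) ≤ (∫⁻ x, ENNReal.ofReal (Real.exp (s * x)) ∂μ) *
      ENNReal.ofReal (Real.exp (-s * x)) := by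
  have h := mul_meas_ge_le_lintegral (μ := μ)
    (f := fun x => ENNReal.ofReal (Real.exp (s * x))) (by fun_prop)
    (ENNReal.ofReal (Real.exp (s * x)))
  have hsub : Set.Ioi x ⊆
      {y | ENNReal.ofReal (Real.exp (s * x)) ≤ ENNReal.ofReal (Real.exp (s * y))} := fun y hy =>
    ENNReal.ofReal_le_ofReal (Real.exp_le_exp.2 (mul_le_mul_of_nonneg_left (le_of_lt hy) hs))
  calc μ (Set.Ioi x) = (ENNReal.ofReal (Real.exp (s * x)) * μ (Set.Ioi x)) *
        ENNReal.ofReal (Real.exp (-s * x)) := by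
        rw [mul_right_comm, ← ENNReal.ofReal_mul (Real.exp_pos _).le, ← Real.exp_add]
        simp
    _ ≤ _ := by
        gcongr
        exact (mul_le_mul_right (measure_mono hsub) _).trans h

/-- The moment generating function of the stationary excess distribution is continuous at `0` when
the tail decays exponentially, so its value at some `s > 0` is as close to `1` as desired. -/
lemma exists_lintegral_exp_stationaryExcess_lt {G : Measure ℝ} [IsProbabilityMeasure G]
    (hG : G (Set.Iio 0) = 0) (hint : Integrable (fun x : ℝ => x) G) (hm : 0 < ∫ x, x ∂G)
    {K c : ℝ} (hc : 0 < c) (htail : ∀ x, 0 ≤ x → G.real (Set.Ioi x) ≤ K * Real.exp (-c * x))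
    {a : ℝ} (ha : 1 < a) :
    ∃ s, 0 < s ∧ ∫⁻ x, ENNReal.ofReal (Real.exp (s * x)) ∂(stationaryExcess G) <
      ENNReal.ofReal a := by
  have := isProbabilityMeasure_stationaryExcess hG hint hm
  have hint' : ∀ t < c, t ∈ integrableExpSet id (stationaryExcess G) := by
    intro t ht
    rw [integrableExpSet, Set.mem_ofPred_eq, stationaryExcess,
      integrable_withDensity_iff_integrable_smul'
        ((measurable_real_Ioi G).div_const _).ennreal_ofReal (ae_of_all _ fun _ => by simp)]
    have hdom : IntegrableOn (fun x : ℝ => K / (∫ x, x ∂G) * Real.exp ((t - c) * x))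
        (Set.Ioi 0) := (integrableOn_exp_mul_Ioi (by linarith) 0).const_mul _
    refine hdom.mono' ?_ ?_
    · exact (((measurable_real_Ioi G).div_const _).ennreal_ofReal.ennreal_toReal.smul
        (by fun_prop)).aestronglyMeasurable
    · filter_upwards [ae_restrict_mem measurableSet_Ioi] with x hx
      rw [ENNReal.toReal_ofReal (by positivity), smul_eq_mul, Real.norm_of_nonneg (by positivity),
        sub_mul, sub_eq_add_neg, Real.exp_add, id]
      calc G.real (Set.Ioi x) / (∫ x, x ∂G) * Real.exp (t * x)
          ≤ K * Real.exp (-c * x) / (∫ x, x ∂G) * Real.exp (t * x) := by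
            gcongr
            exact htail x (le_of_lt hx)
        _ = _ := by rw [neg_mul]; ring
  have hmem : (0 : ℝ) ∈ interior (integrableExpSet id (stationaryExcess G)) :=
    mem_interior.2 ⟨Set.Iio c, fun t ht => hint' t ht, isOpen_Iio, hc⟩
  have hcont : ContinuousAt (mgf id (stationaryExcess G)) 0 :=
    continuousOn_mgf.continuousAt (isOpen_interior.mem_nhds hmem)
  have hev : ∀ᶠ s in 𝓝 (0 : ℝ), mgf id (stationaryExcess G) s < a :=
    hcont.eventually_lt_const (by simpa using ha)
  have hev2 : ∀ᶠ s in 𝓝[>] (0 : ℝ), s < c ∧ mgf id (stationaryExcess G) s < a :=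
    nhdsWithin_le_nhds ((eventually_lt_nhds hc).and hev)
  obtain ⟨s, ⟨hsc, hs⟩, hs0⟩ := (hev2.and self_mem_nhdsWithin).exists
  refine ⟨s, hs0, ?_⟩
  have hi : Integrable (fun x : ℝ => Real.exp (s * x)) (stationaryExcess G) := hint' s hsc
  rw [← ofReal_integral_eq_lintegral_ofReal hi (ae_of_all _ fun x => (Real.exp_pos _).le)]
  exact (ENNReal.ofReal_lt_ofReal_iff (by linarith)).2 hs

/-! ### The supremum of the claim surplus process as the maximum of a random walk -/

/-- The claim surplus just after the first `n` claims: a random walk whose steps are claim size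
minus inter-arrival time. -/
noncomputable def surplusWalk (ω : ℕ → ℝ × ℝ) (n : ℕ) : ℝ :=
  ∑ i ∈ Finset.range n, ((ω i).2 - (ω i).1)

/-- The all-time maximum of the random walk (`0` if the walk is unbounded above, which has
probability `0` under the net profit condition). -/
noncomputable def walkSup (ω : ℕ → ℝ × ℝ) : ℝ := ⨆ n, surplusWalk ω n

/-- The times and sizes are nonnegative, the random walk is bounded above, and arrivals do not
accumulate, so that `claimCount`, a cardinality that would be `0` for an infinite set, does count
the claims up to time `t`. -/
structure IsRegularPath (ω : ℕ → ℝ × ℝ) : Prop where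
  time_nonneg : ∀ i, 0 ≤ (ω i).1
  size_nonneg : ∀ i, 0 ≤ (ω i).2
  tendsto_arrivalTime : Tendsto (arrivalTime ω) atTop atTop
  bddAbove : BddAbove (Set.range (surplusWalk ω))

variable {ω : ℕ → ℝ × ℝ}

lemma IsRegularPath.arrivalTime_mono (hω : IsRegularPath ω) : Monotone (arrivalTime ω) :=
  fun _ _ hab => Finset.sum_le_sum_of_subset_of_nonneg
    (Finset.range_mono (Nat.succ_le_succ hab)) fun i _ _ => hω.time_nonneg i

lemma IsRegularPath.arrivalTime_le_iff (hω : IsRegularPath ω) (t : ℝ≥0) (n : ℕ) :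
    arrivalTime ω n ≤ t ↔ n < claimCount ω t := by
  have hex : ∃ n, (t : ℝ) < arrivalTime ω n := (hω.tendsto_arrivalTime.eventually_gt_atTop _).exists
  classical
  have hset : {n : ℕ | arrivalTime ω n ≤ t} = Set.Iio (Nat.find hex) := by
    ext k
    simp only [Set.mem_ofPred_eq, Set.mem_Iio]
    constructor
    · intro h
      by_contra hk
      have := hω.arrivalTime_mono (not_lt.1 hk)
      linarith [Nat.find_spec hex]
    · intro h
      exact not_lt.1 (Nat.find_min hex h)
  have hcount : claimCount ω t = Nat.find hex := by
    rw [claimCount, hset, Set.ncard_eq_toFinset_card']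
    simp
  rw [hcount]
  exact Set.ext_iff.1 hset n

lemma IsRegularPath.claimSurplus_le (hω : IsRegularPath ω) (t : ℝ≥0) :
    claimSurplus ω t ≤ surplusWalk ω (claimCount ω t) := by
  rw [claimSurplus, surplusWalk, Finset.sum_sub_distrib]
  refine sub_le_sub_left ?_ _
  rcases h : claimCount ω t with _ | k
  · simp
  · exact (hω.arrivalTime_le_iff t k).2 (by omega)

lemma IsRegularPath.exists_surplusWalk_le (hω : IsRegularPath ω) (n : ℕ) :
    ∃ t : ℝ≥0, surplusWalk ω n ≤ claimSurplus ω t := by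
  have hnn : 0 ≤ ∑ i ∈ Finset.range n, (ω i).1 := Finset.sum_nonneg fun i _ => hω.time_nonneg i
  refine ⟨⟨∑ i ∈ Finset.range n, (ω i).1, hnn⟩, ?_⟩
  unfold claimSurplus surplusWalk
  rw [Finset.sum_sub_distrib]
  refine sub_le_sub_right ?_ _
  refine Finset.sum_le_sum_of_subset_of_nonneg (Finset.range_mono ?_)
    fun i _ _ => hω.size_nonneg i
  rcases n with _ | k
  · exact Nat.zero_le _
  · exact (hω.arrivalTime_le_iff _ k).1 le_rfl

lemma IsRegularPath.surplusSup_eq (hω : IsRegularPath ω) :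
    surplusSup ω = (walkSup ω : EReal) := by
  have h1 : (walkSup ω : EReal) = ⨆ n, (surplusWalk ω n : EReal) :=
    EReal.coe_strictMono.monotone.map_ciSup_of_continuousAt
      continuous_coe_real_ereal.continuousAt hω.bddAbove
  rw [h1]
  refine le_antisymm (iSup_le fun t => ?_) (iSup_le fun n => ?_)
  · exact le_iSup_of_le (claimCount ω t) (EReal.coe_le_coe (hω.claimSurplus_le t))
  · obtain ⟨t, ht⟩ := hω.exists_surplusWalk_le n
    exact le_iSup_of_le t (EReal.coe_le_coe ht)

lemma surplusWalk_succ (ω : ℕ → ℝ × ℝ) (n : ℕ) :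
    surplusWalk ω (n + 1) = (ω 0).2 - (ω 0).1 + surplusWalk (fun i => ω (i + 1)) n := by
  rw [surplusWalk, Finset.sum_range_succ', add_comm]
  rfl

/-- Lindley's recursion. -/
lemma walkSup_eq_max (h : BddAbove (Set.range (surplusWalk ω))) :
    walkSup ω = max 0 ((ω 0).2 - (ω 0).1 + walkSup fun i => ω (i + 1)) := by
  have h' : BddAbove (Set.range (surplusWalk fun i => ω (i + 1))) := by
    obtain ⟨b, hb⟩ := h
    refine ⟨b - ((ω 0).2 - (ω 0).1), ?_⟩
    rintro _ ⟨n, rfl⟩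
    have := hb ⟨n + 1, rfl⟩
    rw [surplusWalk_succ] at this
    linarith
  refine le_antisymm (ciSup_le fun n => ?_) (max_le ?_ ?_)
  · rcases n with _ | n
    · simp [surplusWalk]
    · rw [surplusWalk_succ]
      exact le_max_of_le_right (add_le_add_right (le_ciSup h' n) _)
  · exact (show surplusWalk ω 0 = 0 from Finset.sum_range_zero _) ▸ le_ciSup h 0
  · rw [← le_sub_iff_add_le']
    refine ciSup_le fun n => ?_
    rw [le_sub_iff_add_le', ← surplusWalk_succ]
    exact le_ciSup h _

@[fun_prop]
lemma measurable_surplusWalk (n : ℕ) : Measurable fun ω : ℕ → ℝ × ℝ => surplusWalk ω n := by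
  unfold surplusWalk
  fun_prop

@[fun_prop]
lemma measurable_walkSup : Measurable walkSup := Measurable.iSup measurable_surplusWalk

/-! ### Exponential inter-arrival times -/

section Exponential

variable {lam : ℝ}

lemma integral_expMeasure {E : Type*} [NormedAddCommGroup E] [NormedSpace ℝ E] (hlam : 0 < lam)
    (f : ℝ → E) :
    ∫ x, f x ∂(expMeasure lam) = ∫ x in Set.Ioi 0, (lam * Real.exp (-(lam * x))) • f x := by
  rw [expMeasure, gammaMeasure, integral_withDensity_eq_integral_toReal_smul
    (f := gammaPDF 1 lam) (measurable_gammaPDFReal 1 lam).ennreal_ofReal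
    (ae_of_all _ fun x => ENNReal.ofReal_lt_top), ← integral_Ici_eq_integral_Ioi,
    ← integral_indicator measurableSet_Ici]
  refine integral_congr_ae (ae_of_all _ fun x => ?_)
  have h : gammaPDF 1 lam x = exponentialPDF lam x := rfl
  simp only [h, exponentialPDF_eq]
  by_cases hx : 0 ≤ x
  · rw [if_pos hx, Set.indicator_of_mem (by exact hx), ENNReal.toReal_ofReal (by positivity)]
  · rw [if_neg hx, Set.indicator_of_notMem (by exact hx)]
    simp

lemma expMeasure_Iio_zero (hlam : 0 < lam) : expMeasure lam (Set.Iio 0) = 0 := by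
  have := isProbabilityMeasure_expMeasure hlam
  refine measure_mono_null Set.Iio_subset_Iic_self ?_
  have h := cdf_expMeasure_eq hlam 0
  rw [cdf_eq_real] at h
  simpa [measureReal_eq_zero_iff] using h

lemma integrable_id_expMeasure (hlam : 0 < lam) : Integrable (fun x : ℝ => x) (expMeasure lam) := by
  rw [expMeasure, gammaMeasure, integrable_withDensity_iff_integrable_smul'
    (f := gammaPDF 1 lam) (measurable_gammaPDFReal 1 lam).ennreal_ofReal
    (ae_of_all _ fun x => ENNReal.ofReal_lt_top)]
  have h1 : IntegrableOn (fun x : ℝ => lam * (x ^ (1 : ℝ) * Real.exp (-lam * x ^ (1 : ℝ))))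
      (Set.Ioi 0) := (integrableOn_rpow_mul_exp_neg_mul_rpow (by norm_num) one_pos hlam).const_mul _
  refine (h1.integrable_indicator measurableSet_Ioi).congr (ae_of_all _ fun x => ?_)
  have h : gammaPDF 1 lam x = exponentialPDF lam x := rfl
  simp only [h, exponentialPDF_eq]
  rcases lt_trichotomy x 0 with hx | rfl | hx
  · simp [hx.not_ge, hx.le]
  · simp
  · rw [if_pos hx.le, Set.indicator_of_mem (by exact hx), ENNReal.toReal_ofReal (by positivity),
      Real.rpow_one, smul_eq_mul, neg_mul]
    ring

lemma integral_id_expMeasure (hlam : 0 < lam) : ∫ x, x ∂(expMeasure lam) = lam⁻¹ := by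
  rw [integral_expMeasure hlam]
  have h := Real.integral_rpow_mul_exp_neg_mul_Ioi (a := 2) two_pos hlam
  simp only [smul_eq_mul, mul_assoc]
  rw [integral_const_mul]
  have h2 : ∫ x in Set.Ioi (0 : ℝ), Real.exp (-(lam * x)) * x =
      ∫ x in Set.Ioi (0 : ℝ), x ^ ((2 : ℝ) - 1) * Real.exp (-(lam * x)) := by
    norm_num [mul_comm]
  rw [h2, h, Real.Gamma_two, mul_one, Real.rpow_two]
  field_simp

/-- The characteristic function of `(w - T)⁺` for `T` exponential. -/
lemma integral_cexp_max_expMeasure (hlam : 0 < lam) (t : ℝ) {w : ℝ} (hw : 0 ≤ w) :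
    (lam + t * Complex.I) *
        ∫ τ, Complex.exp (t * (max 0 (w - τ) : ℝ) * Complex.I) ∂(expMeasure lam) =
      lam * Complex.exp (t * w * Complex.I) + t * Complex.I * Complex.exp (-(lam * w)) := by
  have ha : (lam : ℂ) + t * Complex.I ≠ 0 := fun h => by
    have := congrArg Complex.re h
    simp at this
    exact hlam.ne' this
  rw [integral_expMeasure hlam]
  set f : ℝ → ℂ := fun τ => (lam * Real.exp (-(lam * τ))) •
    Complex.exp (t * (max 0 (w - τ) : ℝ) * Complex.I) with hf
  have e1 : Set.EqOn f (fun τ : ℝ => lam * Complex.exp (t * w * Complex.I) *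
      Complex.exp (-(lam + t * Complex.I) * τ)) (Set.Ioc 0 w) := by
    intro τ hτ
    simp only [hf, max_eq_right (sub_nonneg.2 hτ.2), Complex.real_smul]
    push_cast
    rw [mul_assoc (lam : ℂ), mul_assoc (lam : ℂ), ← Complex.exp_add, ← Complex.exp_add]
    ring_nf
  have e2 : Set.EqOn f (fun τ : ℝ => lam * Complex.exp (-(lam : ℂ) * τ)) (Set.Ioi w) := by
    intro τ hτ
    simp only [hf, max_eq_left (sub_nonpos.2 (le_of_lt (Set.mem_Ioi.1 hτ))), Complex.real_smul]
    push_cast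
    simp
  have hre : (-(lam : ℂ)).re < 0 := by simpa using hlam
  have i1 : IntegrableOn f (Set.Ioc 0 w) :=
    IntegrableOn.congr_fun (Continuous.integrableOn_Ioc (by fun_prop)) e1.symm measurableSet_Ioc
  have i2 : IntegrableOn f (Set.Ioi w) :=
    IntegrableOn.congr_fun ((integrableOn_exp_mul_complex_Ioi hre w).const_mul _) e2.symm
      measurableSet_Ioi
  rw [← Set.Ioc_union_Ioi_eq_Ioi hw, setIntegral_union (Set.Ioc_disjoint_Ioi le_rfl)
    measurableSet_Ioi i1 i2, setIntegral_congr_fun measurableSet_Ioc e1,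
    setIntegral_congr_fun measurableSet_Ioi e2, integral_const_mul, integral_const_mul,
    ← intervalIntegral.integral_of_le hw, integral_exp_mul_complex (neg_ne_zero.2 ha),
    integral_exp_mul_complex_Ioi hre]
  have hl : (lam : ℂ) ≠ 0 := by exact_mod_cast hlam.ne'
  have e3 : Complex.exp (-(lam + t * Complex.I) * w) * Complex.exp (t * w * Complex.I) =
      Complex.exp (-(lam * w)) := by
    rw [← Complex.exp_add]; ring_nf
  simp only [Complex.ofReal_zero, mul_zero, Complex.exp_zero, neg_mul (lam : ℂ)]
  generalize Complex.exp (-(lam + t * Complex.I) * w) = P at e3 ⊢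
  generalize Complex.exp (t * w * Complex.I) = A at e3 ⊢
  field_simp
  linear_combination (-(lam : ℂ)) * e3

end Exponential

/-! ### Sequences of independent, identically distributed variables -/

section IID

variable {α : Type*} [MeasurableSpace α] (μ : Measure α) [IsProbabilityMeasure μ]

lemma ae_tendsto_sum_div_infinitePi {f : α → ℝ} (hf : Measurable f) (hint : Integrable f μ) :
    ∀ᵐ ω ∂(Measure.infinitePi fun _ : ℕ => μ),
      Tendsto (fun n : ℕ => (∑ i ∈ Finset.range n, f (ω i)) / n) atTop (𝓝 (∫ x, f x ∂μ)) := by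
  have hmp : ∀ i : ℕ, MeasurePreserving (Function.eval i) (Measure.infinitePi fun _ : ℕ => μ) μ :=
    fun i => measurePreserving_eval_infinitePi (fun _ : ℕ => μ) i
  have h := strong_law_ae_real (μ := Measure.infinitePi fun _ : ℕ => μ)
    (fun i (ω : ℕ → α) => f (ω i)) ((hmp 0).integrable_comp_of_integrable hint)
    (fun i j hij => (iIndepFun_infinitePi (X := fun _ => f) fun _ => hf).indepFun hij)
    (fun i => ⟨(hf.comp (measurable_pi_apply i)).aemeasurable,
      (hf.comp (measurable_pi_apply 0)).aemeasurable, by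
        rw [← Function.comp_def f, ← Function.comp_def f, ← Measure.map_map hf (by fun_prop),
          ← Measure.map_map hf (by fun_prop)]
        exact congrArg _ ((hmp i).map_eq.trans (hmp 0).map_eq.symm)⟩)
  have hmean : ∫ ω, f (ω 0) ∂(Measure.infinitePi fun _ : ℕ => μ) = ∫ x, f x ∂μ := by
    have h1 := integral_map (μ := Measure.infinitePi fun _ : ℕ => μ) (φ := Function.eval 0)
      (hmp 0).measurable.aemeasurable (f := f) hf.aestronglyMeasurable
    rw [(hmp 0).map_eq] at h1
    exact h1.symm
  rwa [hmean] at h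

lemma infinitePi_ae_all {p : α → Prop} (hp : ∀ᵐ x ∂μ, p x) :
    ∀ᵐ ω ∂(Measure.infinitePi fun _ : ℕ => μ), ∀ i, p (ω i) :=
  ae_all_iff.2 fun i =>
    (measurePreserving_eval_infinitePi (fun _ : ℕ => μ) i).quasiMeasurePreserving.ae hp

/-- Prepending an independent variable to an i.i.d. sequence. -/
def consSeq (z : α × (ℕ → α)) : ℕ → α
  | 0 => z.1
  | n + 1 => z.2 n

@[fun_prop]
lemma measurable_consSeq : Measurable (consSeq (α := α)) := by
  refine measurable_pi_lambda _ fun n => ?_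
  rcases n with _ | n
  · exact measurable_fst
  · exact (measurable_pi_apply n).comp measurable_snd

lemma map_consSeq_prod_infinitePi :
    (μ.prod (Measure.infinitePi fun _ : ℕ => μ)).map consSeq = Measure.infinitePi fun _ => μ := by
  classical
  refine Measure.eq_infinitePi _ fun s t ht => ?_
  obtain ⟨N, hN⟩ : ∃ N, s ⊆ Finset.range (N + 1) :=
    ⟨s.sup id, fun i hi => Finset.mem_range_succ_iff.2 (Finset.le_sup (f := id) hi)⟩
  set t' : ℕ → Set α := fun i => if i ∈ s then t i else Set.univ
  have ht' : ∀ i, MeasurableSet (t' i) := fun i => by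
    simp only [t']
    split_ifs
    · exact ht i
    · exact MeasurableSet.univ
  have hpre : consSeq ⁻¹' (Set.pi s t) =
      t' 0 ×ˢ Set.pi (Finset.range N) fun i => t' (i + 1) := by
    ext ⟨x, ω⟩
    simp only [Set.mem_preimage, Set.mem_pi, Finset.mem_coe, Set.mem_prod, Finset.mem_range, t']
    constructor
    · intro h
      refine ⟨?_, fun i _ => ?_⟩
      · split_ifs with h0
        · exact h 0 h0
        · trivial
      · split_ifs with hi
        · exact h (i + 1) hi
        · trivial
    · rintro ⟨h0, h1⟩ i hi
      rcases i with _ | i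
      · simpa [hi, consSeq] using h0
      · have := h1 i (by have := Finset.mem_range.1 (hN hi); omega)
        simpa [hi, consSeq] using this
  rw [Measure.map_apply measurable_consSeq
    (MeasurableSet.pi s.countable_toSet fun i _ => ht i), hpre, Measure.prod_prod,
    Measure.infinitePi_pi _ fun i _ => ht' _]
  rw [mul_comm, ← Finset.prod_range_succ' (fun i => μ (t' i))]
  rw [← Finset.prod_subset hN]
  · exact Finset.prod_congr rfl fun i hi => by simp [t', hi]
  · intro i _ hi
    simp [t', hi]

end IID

/-! ### Lindley's equation for the law of the supremum -/

section Law

variable {lam : ℝ} {G : Measure ℝ}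

lemma isProbabilityMeasure_claimsMeasure (hlam : 0 < lam) [IsProbabilityMeasure G] :
    IsProbabilityMeasure (claimsMeasure lam G) := by
  have := isProbabilityMeasure_expMeasure hlam
  unfold claimsMeasure
  infer_instance

/-- The strong law of large numbers gives both the non-accumulation of arrivals and, under the net
profit condition, the drift to `-∞` of the random walk. -/
lemma ae_isRegularPath (hlam : 0 < lam) [IsProbabilityMeasure G] (hG : G (Set.Iio 0) = 0)
    (hint : Integrable (fun x : ℝ => x) G) (hm : lam * ∫ x, x ∂G < 1) :
    ∀ᵐ ω ∂(claimsMeasure lam G), IsRegularPath ω := by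
  have := isProbabilityMeasure_expMeasure hlam
  have hT : Integrable (fun z : ℝ × ℝ => z.1) ((expMeasure lam).prod G) :=
    (integrable_id_expMeasure hlam).comp_fst G
  have hY : Integrable (fun z : ℝ × ℝ => z.2) ((expMeasure lam).prod G) :=
    hint.comp_snd (expMeasure lam)
  have iT : ∫ z : ℝ × ℝ, z.1 ∂((expMeasure lam).prod G) = lam⁻¹ := by
    rw [integral_fun_fst (fun x : ℝ => x), integral_id_expMeasure hlam]
    simp
  have iY : ∫ z : ℝ × ℝ, z.2 ∂((expMeasure lam).prod G) = ∫ x, x ∂G := by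
    rw [integral_fun_snd (fun x : ℝ => x)]
    simp
  have h1 : ∀ᵐ z ∂((expMeasure lam).prod G), 0 ≤ z.1 :=
    Measure.quasiMeasurePreserving_fst.ae (ae_nonneg_of_Iio_zero (expMeasure_Iio_zero hlam))
  have h2 : ∀ᵐ z ∂((expMeasure lam).prod G), 0 ≤ z.2 :=
    Measure.quasiMeasurePreserving_snd.ae (ae_nonneg_of_Iio_zero hG)
  have h3 := ae_tendsto_sum_div_infinitePi _ measurable_fst hT
  have h4 := ae_tendsto_sum_div_infinitePi _ (measurable_snd.sub measurable_fst) (hY.sub hT)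
  unfold claimsMeasure
  filter_upwards [infinitePi_ae_all _ h1, infinitePi_ae_all _ h2, h3, h4] with ω w1 w2 w3 w4
  have hn : Tendsto (fun n : ℕ => (n : ℝ)) atTop atTop := tendsto_natCast_atTop_atTop
  have hmul : ∀ a : ℕ → ℝ, ∀ᶠ n : ℕ in atTop, a n / n * n = a n := fun a => by
    filter_upwards [eventually_gt_atTop 0] with n hn
    field_simp
  refine ⟨w1, w2, ?_, ?_⟩
  · rw [iT] at w3
    exact (tendsto_add_atTop_iff_nat 1).2
      ((w3.pos_mul_atTop (inv_pos.2 hlam) hn).congr' (hmul _))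
  · have hneg : ∫ z : ℝ × ℝ, (z.2 - z.1) ∂((expMeasure lam).prod G) < 0 := by
      rw [integral_sub hY hT, iT, iY, sub_neg, ← mul_lt_mul_iff_right₀ hlam,
        mul_inv_cancel₀ hlam.ne']
      exact hm
    have h5 := (w4.neg_mul_atTop hneg hn).congr' (hmul _)
    exact h5.isBoundedUnder_le_atBot.bddAbove_range

lemma supLaw_eq_map_walkSup (h : ∀ᵐ ω ∂(claimsMeasure lam G), IsRegularPath ω) :
    supLaw lam G = (claimsMeasure lam G).map walkSup := by
  refine Measure.map_congr ?_
  filter_upwards [h] with ω hω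
  rw [hω.surplusSup_eq, EReal.toReal_coe]

lemma ruinProb_eq_supLaw (h : ∀ᵐ ω ∂(claimsMeasure lam G), IsRegularPath ω) (u : ℝ) :
    ruinProb lam G u = (supLaw lam G).real (Set.Ioi u) := by
  rw [supLaw_eq_map_walkSup h, map_measureReal_apply measurable_walkSup measurableSet_Ioi, ruinProb]
  refine measureReal_congr ?_
  filter_upwards [h] with ω hω
  refine propext ?_
  change (u : EReal) < surplusSup ω ↔ u < walkSup ω
  rw [hω.surplusSup_eq, EReal.coe_lt_coe_iff]

lemma isProbabilityMeasure_supLaw (hlam : 0 < lam) [IsProbabilityMeasure G]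
    (h : ∀ᵐ ω ∂(claimsMeasure lam G), IsRegularPath ω) : IsProbabilityMeasure (supLaw lam G) := by
  have := isProbabilityMeasure_claimsMeasure (G := G) hlam
  rw [supLaw_eq_map_walkSup h]
  exact Measure.isProbabilityMeasure_map measurable_walkSup.aemeasurable

lemma supLaw_Iio_zero (h : ∀ᵐ ω ∂(claimsMeasure lam G), IsRegularPath ω) :
    supLaw lam G (Set.Iio 0) = 0 := by
  rw [supLaw_eq_map_walkSup h, Measure.map_apply measurable_walkSup measurableSet_Iio]
  refine measure_eq_zero_iff_ae_notMem.2 ?_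
  filter_upwards [h] with ω hω
  simp only [Set.mem_preimage, Set.mem_Iio, not_lt]
  rw [walkSup_eq_max hω.bddAbove]
  exact le_max_left _ _

/-- With `M` the supremum, `Y` a claim and `T` an inter-arrival time, all independent,
`M` and `(Y + M - T)⁺` have the same law. -/
lemma supLaw_eq_map_max (hlam : 0 < lam) [IsProbabilityMeasure G]
    (h : ∀ᵐ ω ∂(claimsMeasure lam G), IsRegularPath ω) :
    supLaw lam G = ((expMeasure lam).prod (G.conv (supLaw lam G))).map
      fun z => max 0 (z.2 - z.1) := by
  have := isProbabilityMeasure_expMeasure hlam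
  have := isProbabilityMeasure_claimsMeasure (G := G) hlam
  have := isProbabilityMeasure_supLaw hlam h
  have hmap := supLaw_eq_map_walkSup h
  have hstep : (claimsMeasure lam G).map walkSup = (claimsMeasure lam G).map
      fun ω => max 0 ((ω 0).2 - (ω 0).1 + walkSup fun i => ω (i + 1)) := by
    refine Measure.map_congr ?_
    filter_upwards [h] with ω hω
    exact walkSup_eq_max hω.bddAbove
  have hcons : (((expMeasure lam).prod G).prod (claimsMeasure lam G)).map consSeq =
      claimsMeasure lam G := map_consSeq_prod_infinitePi _
  have hprod : ((expMeasure lam).prod G).prod (supLaw lam G) =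
      (((expMeasure lam).prod G).prod (claimsMeasure lam G)).map (Prod.map id walkSup) := by
    rw [← Measure.map_prod_map _ _ measurable_id measurable_walkSup, Measure.map_id, hmap]
  have hconv : (expMeasure lam).prod (G.conv (supLaw lam G)) =
      ((expMeasure lam).prod (G.prod (supLaw lam G))).map
        (Prod.map id fun z : ℝ × ℝ => z.1 + z.2) := by
    rw [← Measure.map_prod_map _ _ measurable_id (by fun_prop), Measure.map_id]
    rfl
  rw [hconv, ← Measure.prodAssoc_prod, hprod, Measure.map_map (by fun_prop) (by fun_prop),
    Measure.map_map (by fun_prop) MeasurableEquiv.prodAssoc.measurable, Measure.map_map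
      (Measurable.comp (by fun_prop) MeasurableEquiv.prodAssoc.measurable) (by fun_prop),
    hmap, hstep]
  conv_lhs => rw [← hcons]
  rw [Measure.map_map (by fun_prop) (by fun_prop)]
  congr 1
  ext z
  change max 0 (z.1.2 - z.1.1 + walkSup z.2) = max 0 (z.1.2 + walkSup z.2 - z.1.1)
  ring_nf

/-- Lindley's equation in terms of characteristic functions. -/
lemma exists_charFun_supLaw_mul (hlam : 0 < lam) [IsProbabilityMeasure G] (hG : G (Set.Iio 0) = 0)
    (h : ∀ᵐ ω ∂(claimsMeasure lam G), IsRegularPath ω) :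
    ∃ c : ℂ, ∀ t : ℝ, charFun (supLaw lam G) t * (lam + t * Complex.I - lam * charFun G t) =
      t * Complex.I * c := by
  have := isProbabilityMeasure_expMeasure hlam
  have := isProbabilityMeasure_supLaw hlam h
  have hW := ae_nonneg_of_Iio_zero (conv_Iio_zero hG (supLaw_Iio_zero h))
  refine ⟨∫ w, Complex.exp (-(lam * w)) ∂(G.conv (supLaw lam G)), fun t => ?_⟩
  have hnorm : ∀ x : ℝ, ‖Complex.exp (t * x * Complex.I)‖ = 1 := fun x => by
    exact_mod_cast Complex.norm_exp_ofReal_mul_I (t * x)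
  have hL : (lam + t * Complex.I) * charFun (supLaw lam G) t = ∫ w,
      (lam * Complex.exp (t * w * Complex.I) + t * Complex.I * Complex.exp (-(lam * w)))
        ∂(G.conv (supLaw lam G)) := by
    conv_lhs => rw [supLaw_eq_map_max hlam h, charFun_apply_real]
    rw [integral_map (by fun_prop) (by fun_prop), integral_prod_symm, ← integral_const_mul]
    · refine integral_congr_ae ?_
      filter_upwards [hW] with w hw
      exact integral_cexp_max_expMeasure hlam t hw
    · exact Integrable.of_bound (C := 1) (by fun_prop) (ae_of_all _ fun z => (hnorm _).le)
  have hi1 : Integrable (fun w : ℝ => (lam : ℂ) * Complex.exp (t * w * Complex.I))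
      (G.conv (supLaw lam G)) :=
    (Integrable.of_bound (C := 1) (by fun_prop) (ae_of_all _ fun z => (hnorm _).le)).const_mul _
  have hi2 : Integrable (fun w : ℝ => t * Complex.I * Complex.exp (-(lam * w)))
      (G.conv (supLaw lam G)) := by
    refine (Integrable.of_bound (C := 1) (by fun_prop) ?_).const_mul _
    filter_upwards [hW] with w hw
    rw [Complex.norm_exp]
    simpa using mul_nonneg hlam.le hw
  rw [integral_add hi1 hi2, integral_const_mul, integral_const_mul, ← charFun_apply_real,
    charFun_conv] at hL
  linear_combination hL

end Law

/-! ### Renewal equations for the laws of the suprema -/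

lemma charFun_convPow (μ : Measure ℝ) [IsProbabilityMeasure μ] (n : ℕ) (t : ℝ) :
    charFun (convPow μ n) t = charFun μ t ^ n := by
  induction n with
  | zero => simp [convPow]
  | succ n ih => rw [convPow, charFun_conv, ih, pow_succ]

instance isFiniteMeasure_ofReal_smul_add (μ ν : Measure ℝ) [IsFiniteMeasure μ] [IsFiniteMeasure ν]
    (a b : ℝ) : IsFiniteMeasure (ENNReal.ofReal a • μ + ENNReal.ofReal b • ν) := by
  have := μ.smul_finite (ENNReal.ofReal_ne_top (r := a))
  have := ν.smul_finite (ENNReal.ofReal_ne_top (r := b))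
  infer_instance

lemma charFun_ofReal_smul_add (μ ν : Measure ℝ) [IsProbabilityMeasure μ] [IsProbabilityMeasure ν]
    {a b : ℝ} (ha : 0 ≤ a) (hb : 0 ≤ b) (t : ℝ) :
    charFun (ENNReal.ofReal a • μ + ENNReal.ofReal b • ν) t =
      a * charFun μ t + b * charFun ν t := by
  have hi : ∀ (ρ : Measure ℝ) [IsProbabilityMeasure ρ],
      Integrable (fun x : ℝ => Complex.exp (t * x * Complex.I)) ρ := fun ρ _ =>
    Integrable.of_bound (C := 1) (by fun_prop) (ae_of_all _ fun x => by
      exact_mod_cast (Complex.norm_exp_ofReal_mul_I (t * x)).le)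
  simp only [charFun_apply_real]
  rw [integral_add_measure ((hi μ).smul_measure ENNReal.ofReal_ne_top)
    ((hi ν).smul_measure ENNReal.ofReal_ne_top), integral_smul_measure, integral_smul_measure,
    ENNReal.toReal_ofReal ha, ENNReal.toReal_ofReal hb, Complex.real_smul, Complex.real_smul]

/-- Division by `i t`; the value at `t = 0` is recovered by continuity. -/
lemma eq_of_mul_I_eq {f g : ℝ → ℂ} (hf : Continuous f) (hg : Continuous g)
    (h : ∀ t : ℝ, t * Complex.I * f t = t * Complex.I * g t) : f = g := by
  refine Continuous.ext_on (dense_compl_singleton (0 : ℝ)) hf hg fun t ht => ?_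
  exact mul_left_cancel₀ (by simpa using ht) (h t)

section Mixture

variable {B D : Measure ℝ} {ε : ℝ}

lemma isProbabilityMeasure_mixtureClaim [IsProbabilityMeasure B] [IsProbabilityMeasure D]
    (h0 : 0 ≤ ε) (h1 : ε ≤ 1) :
    IsProbabilityMeasure (mixtureClaim B D ε) := by
  refine ⟨?_⟩
  simp only [mixtureClaim, Measure.add_apply, Measure.smul_apply, measure_univ, smul_eq_mul,
    mul_one]
  rw [← ENNReal.ofReal_add (by linarith) h0]
  simp

lemma mixtureClaim_Iio_zero (hB : B (Set.Iio 0) = 0) (hD : D (Set.Iio 0) = 0) :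
    mixtureClaim B D ε (Set.Iio 0) = 0 := by
  simp [mixtureClaim, hB, hD]

lemma integrable_mixtureClaim (hB : Integrable (fun x : ℝ => x) B)
    (hD : Integrable (fun x : ℝ => x) D) : Integrable (fun x : ℝ => x) (mixtureClaim B D ε) :=
  (hB.smul_measure ENNReal.ofReal_ne_top).add_measure (hD.smul_measure ENNReal.ofReal_ne_top)

lemma integral_mixtureClaim (h0 : 0 ≤ ε) (h1 : ε ≤ 1) (hB : Integrable (fun x : ℝ => x) B)
    (hD : Integrable (fun x : ℝ => x) D) :
    ∫ x, x ∂(mixtureClaim B D ε) = (1 - ε) * ∫ x, x ∂B + ε * ∫ x, x ∂D := by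
  rw [mixtureClaim, integral_add_measure (hB.smul_measure ENNReal.ofReal_ne_top)
    (hD.smul_measure ENNReal.ofReal_ne_top), integral_smul_measure, integral_smul_measure,
    ENNReal.toReal_ofReal (by linarith), ENNReal.toReal_ofReal h0, smul_eq_mul, smul_eq_mul]

end Mixture

section Renewal

variable {lam ε : ℝ} {B C : Measure ℝ} [IsProbabilityMeasure B]

lemma ae_isRegularPath_mixtureClaim [IsProbabilityMeasure C] (hlam : 0 < lam) (h0 : 0 ≤ ε)
    (h1 : ε ≤ 1) (hB : B (Set.Iio 0) = 0) (hC : C (Set.Iio 0) = 0)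
    (hBi : Integrable (fun x : ℝ => x) B) (hCi : Integrable (fun x : ℝ => x) C)
    (hstab : (1 - ε) * (lam * ∫ x, x ∂B) + ε * (lam * ∫ x, x ∂C) < 1) :
    ∀ᵐ ω ∂(claimsMeasure lam (mixtureClaim B C ε)), IsRegularPath ω := by
  have := isProbabilityMeasure_mixtureClaim (B := B) (D := C) h0 h1
  refine ae_isRegularPath hlam (mixtureClaim_Iio_zero hB hC) (integrable_mixtureClaim hBi hCi) ?_
  rw [integral_mixtureClaim h0 h1 hBi hCi]
  linarith

lemma ae_isRegularPath_discardClaim (hlam : 0 < lam) (h0 : 0 ≤ ε)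
    (h1 : ε ≤ 1) (hB : B (Set.Iio 0) = 0) (hBi : Integrable (fun x : ℝ => x) B)
    (hBm : 0 < ∫ x, x ∂B) (hstab : lam * ∫ x, x ∂B < 1) :
    ∀ᵐ ω ∂(claimsMeasure lam (discardClaim B ε)), IsRegularPath ω := by
  refine ae_isRegularPath_mixtureClaim hlam h0 h1 hB (by simp) hBi
    (integrable_dirac (by simp)) ?_
  have : 0 ≤ ε * (lam * ∫ x, x ∂B) := by positivity
  simp only [integral_dirac]
  linarith

/-- The Pollaczek–Khinchine renewal equation for the model without the `C`-claims, in terms of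
characteristic functions. -/
lemma charFun_supLaw_discardClaim (hlam : 0 < lam) (h0 : 0 ≤ ε)
    (h1 : ε ≤ 1) (hB : B (Set.Iio 0) = 0) (hBi : Integrable (fun x : ℝ => x) B)
    (hBm : 0 < ∫ x, x ∂B) (hstab : lam * ∫ x, x ∂B < 1) (t : ℝ) :
    charFun (supLaw lam (discardClaim B ε)) t *
      (1 - (1 - ε) * (lam * ∫ x, x ∂B : ℝ) * charFun (stationaryExcess B) t) =
      1 - (1 - ε) * (lam * ∫ x, x ∂B : ℝ) := by
  have hreg := ae_isRegularPath_discardClaim hlam h0 h1 hB hBi hBm hstab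
  have : IsProbabilityMeasure (mixtureClaim B (Measure.dirac 0) ε) :=
    isProbabilityMeasure_mixtureClaim h0 h1
  have : IsProbabilityMeasure (discardClaim B ε) := this
  have := isProbabilityMeasure_supLaw hlam hreg
  have := isProbabilityMeasure_stationaryExcess hB hBi hBm
  obtain ⟨c, hc⟩ := exists_charFun_supLaw_mul hlam (mixtureClaim_Iio_zero hB (by simp)) hreg
  have key : (fun t => charFun (supLaw lam (discardClaim B ε)) t *
      (1 - (1 - ε) * (lam * ∫ x, x ∂B : ℝ) * charFun (stationaryExcess B) t)) = fun _ => c := by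
    refine eq_of_mul_I_eq (by fun_prop) (by fun_prop) fun t => ?_
    rw [← hc t, discardClaim, mixtureClaim, charFun_ofReal_smul_add _ _ (by linarith) h0]
    have h := charFun_stationaryExcess hB hBi hBm t
    simp only [charFun_dirac, inner_zero_left, Complex.ofReal_zero, zero_mul, Complex.exp_zero]
    push_cast
    linear_combination (-(lam : ℂ) * (1 - ε) *
      charFun (supLaw lam (ENNReal.ofReal (1 - ε) • B + ENNReal.ofReal ε • Measure.dirac 0)) t) * h
  -- At `t = 0` all characteristic functions are `1`, which identifies the constant `c`.
  have h00 := congrFun key 0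
  simp only [charFun_zero, probReal_univ, Complex.ofReal_one, mul_one, one_mul] at h00
  rw [h00]
  exact congrFun key t

lemma supLaw_discardClaim_renewal (hlam : 0 < lam) (h0 : 0 ≤ ε)
    (h1 : ε ≤ 1) (hB : B (Set.Iio 0) = 0) (hBi : Integrable (fun x : ℝ => x) B)
    (hBm : 0 < ∫ x, x ∂B) (hstab : lam * ∫ x, x ∂B < 1) :
    supLaw lam (discardClaim B ε) =
      ENNReal.ofReal (1 - (1 - ε) * (lam * ∫ x, x ∂B)) • Measure.dirac 0 +
      ENNReal.ofReal ((1 - ε) * (lam * ∫ x, x ∂B)) •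
        (supLaw lam (discardClaim B ε)).conv (stationaryExcess B) := by
  have hreg := ae_isRegularPath_discardClaim hlam h0 h1 hB hBi hBm hstab
  have : IsProbabilityMeasure (mixtureClaim B (Measure.dirac 0) ε) :=
    isProbabilityMeasure_mixtureClaim h0 h1
  have : IsProbabilityMeasure (discardClaim B ε) := this
  have := isProbabilityMeasure_supLaw hlam hreg
  have := isProbabilityMeasure_stationaryExcess hB hBi hBm
  have hδ : 0 ≤ ε * (lam * ∫ x, x ∂B) := by positivity
  have hr : 0 ≤ (1 - ε) * (lam * ∫ x, x ∂B) := mul_nonneg (by linarith) (by positivity)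
  refine Measure.ext_of_charFun (funext fun t => ?_)
  rw [charFun_ofReal_smul_add _ _ (by linarith) hr, charFun_conv]
  have h := charFun_supLaw_discardClaim hlam h0 h1 hB hBi hBm hstab t
  simp only [charFun_dirac, inner_zero_left, Complex.ofReal_zero, zero_mul, Complex.exp_zero]
  push_cast at h ⊢
  linear_combination h

/-- Expansion around the model without the `C`-claims: the law `μ` of the supremum solves
`μ = (1 - q) ν + q μ ∗ (Cᵉ ∗ ν)`, with `ν` the law of the supremum when the `C`-claims are
discarded and `q` the discard coefficient. -/
lemma supLaw_mixtureClaim_renewal [IsProbabilityMeasure C] (hlam : 0 < lam) (h0 : 0 ≤ ε)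
    (h1 : ε ≤ 1) (hB : B (Set.Iio 0) = 0) (hC : C (Set.Iio 0) = 0)
    (hBi : Integrable (fun x : ℝ => x) B) (hCi : Integrable (fun x : ℝ => x) C)
    (hBm : 0 < ∫ x, x ∂B) (hCm : 0 < ∫ x, x ∂C) (hstab : lam * ∫ x, x ∂B < 1)
    (hq : discardCoeff lam B C ε < 1) :
    supLaw lam (mixtureClaim B C ε) =
      ENNReal.ofReal (1 - discardCoeff lam B C ε) • supLaw lam (discardClaim B ε) +
      ENNReal.ofReal (discardCoeff lam B C ε) • (supLaw lam (mixtureClaim B C ε)).conv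
        ((stationaryExcess C).conv (supLaw lam (discardClaim B ε))) := by
  have hδ : 0 ≤ ε * (lam * ∫ x, x ∂B) := by positivity
  have hden : 0 < 1 - lam * (∫ x, x ∂B) + ε * (lam * ∫ x, x ∂B) := by linarith
  have hq0 : 0 ≤ discardCoeff lam B C ε := div_nonneg (by positivity) hden.le
  have hreg := ae_isRegularPath_discardClaim hlam h0 h1 hB hBi hBm hstab
  have hstab' : (1 - ε) * (lam * ∫ x, x ∂B) + ε * (lam * ∫ x, x ∂C) < 1 := by
    rw [discardCoeff, div_lt_one hden] at hq
    linarith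
  have hreg' := ae_isRegularPath_mixtureClaim hlam h0 h1 hB hC hBi hCi hstab'
  have : IsProbabilityMeasure (mixtureClaim B (Measure.dirac 0) ε) :=
    isProbabilityMeasure_mixtureClaim h0 h1
  have : IsProbabilityMeasure (discardClaim B ε) := this
  have : IsProbabilityMeasure (mixtureClaim B C ε) := isProbabilityMeasure_mixtureClaim h0 h1
  have := isProbabilityMeasure_supLaw hlam hreg
  have := isProbabilityMeasure_supLaw hlam hreg'
  have := isProbabilityMeasure_stationaryExcess hB hBi hBm
  have := isProbabilityMeasure_stationaryExcess hC hCi hCm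
  obtain ⟨c, hc⟩ := exists_charFun_supLaw_mul hlam (mixtureClaim_Iio_zero hB hC) hreg'
  have key : (fun t => charFun (supLaw lam (mixtureClaim B C ε)) t *
      (1 - (1 - ε) * (lam * ∫ x, x ∂B : ℝ) * charFun (stationaryExcess B) t -
        ε * (lam * ∫ x, x ∂C : ℝ) * charFun (stationaryExcess C) t)) = fun _ => c := by
    refine eq_of_mul_I_eq (by fun_prop) (by fun_prop) fun t => ?_
    rw [← hc t]
    have hmix := charFun_ofReal_smul_add B C (show 0 ≤ 1 - ε by linarith) h0 t
    rw [← mixtureClaim] at hmix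
    rw [hmix]
    have hb := charFun_stationaryExcess hB hBi hBm t
    have hcc := charFun_stationaryExcess hC hCi hCm t
    push_cast
    linear_combination (-(lam : ℂ) * (1 - ε) * charFun (supLaw lam (mixtureClaim B C ε)) t) * hb +
      (-(lam : ℂ) * ε * charFun (supLaw lam (mixtureClaim B C ε)) t) * hcc
  have h00 := congrFun key 0
  simp only [charFun_zero, probReal_univ, Complex.ofReal_one, mul_one, one_mul] at h00
  refine Measure.ext_of_charFun (funext fun t => ?_)
  rw [charFun_ofReal_smul_add _ _ (by linarith) hq0, charFun_conv, charFun_conv]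
  have hN := charFun_supLaw_discardClaim hlam h0 h1 hB hBi hBm hstab t
  have hL := congrFun key t
  simp only [← h00] at hL
  have hdenC : (1 : ℂ) - (lam * ∫ x, x ∂B : ℝ) + ε * (lam * ∫ x, x ∂B : ℝ) ≠ 0 := by
    exact_mod_cast hden.ne'
  have hqC : (discardCoeff lam B C ε : ℂ) *
      (1 - (lam * ∫ x, x ∂B : ℝ) + ε * (lam * ∫ x, x ∂B : ℝ)) = ε * (lam * ∫ x, x ∂C : ℝ) := by
    have h : discardCoeff lam B C ε * (1 - lam * (∫ x, x ∂B) + ε * (lam * ∫ x, x ∂B)) =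
      ε * (lam * ∫ x, x ∂C) := div_mul_cancel₀ _ hden.ne'
    exact_mod_cast h
  -- Eliminate the characteristic function of `Bᵉ` between the two relations `hN` and `hL`.
  refine mul_left_cancel₀ hdenC ?_
  rw [Complex.ofReal_sub, Complex.ofReal_one]
  generalize (lam * ∫ x, x ∂B : ℝ) = δ at *
  generalize (lam * ∫ x, x ∂C : ℝ) = θ at *
  generalize charFun (supLaw lam (mixtureClaim B C ε)) t = L at *
  generalize charFun (supLaw lam (discardClaim B ε)) t = N at *
  generalize charFun (stationaryExcess C) t = f at *
  generalize charFun (stationaryExcess B) t = e at *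
  linear_combination N * hL - L * hN + (N - L * f * N) * hqC

end Renewal

/-! ### Tail bounds uniform in the mixing probability -/

lemma conv_convPow_Ioi_le_of_le {F ν κ : Measure ℝ} [IsProbabilityMeasure F]
    [IsProbabilityMeasure ν] [IsProbabilityMeasure κ] {S a b : ℝ≥0∞}
    (hS : ∀ x, (F.conv F) (Set.Ioi x) ≤ S * F (Set.Ioi x))
    (hν : ∀ x, ν (Set.Ioi x) ≤ a * F (Set.Ioi x)) (hκ : ∀ x, κ (Set.Ioi x) ≤ b * F (Set.Ioi x))
    (n : ℕ) (x : ℝ) : (ν.conv (convPow κ n)) (Set.Ioi x) ≤ a * (b * S) ^ n * F (Set.Ioi x) := by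
  induction n generalizing x with
  | zero => simpa [convPow] using hν x
  | succ n ih =>
    rw [convPow, ← Measure.conv_assoc]
    refine (conv_Ioi_le_of_le hS ih hκ x).trans (le_of_eq ?_)
    ring

section

variable {lam : ℝ} {B : Measure ℝ}

/-- The suprema in the models without the `C`-claims have a common exponential tail bound, by the
Chernoff bound for the terms of the Pollaczek–Khinchine series. -/
lemma exists_supLaw_discardClaim_Ioi_le_exp (hlam : 0 < lam) (hB : IsPhaseType B)
    (hBi : Integrable (fun x : ℝ => x) B) (hBm : 0 < ∫ x, x ∂B) (hstab : lam * ∫ x, x ∂B < 1) :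
    ∃ (K : ℝ≥0∞) (s : ℝ), K ≠ ∞ ∧ 0 < s ∧ ∀ ε : ℝ, 0 ≤ ε → ε ≤ 1 → ∀ x,
      supLaw lam (discardClaim B ε) (Set.Ioi x) ≤ K * ENNReal.ofReal (Real.exp (-s * x)) := by
  have := hB.isProbabilityMeasure
  have := isProbabilityMeasure_stationaryExcess hB.concentrated hBi hBm
  set δ := lam * ∫ x, x ∂B with hδ
  have hδ0 : 0 < δ := by positivity
  obtain ⟨K₀, c, hc, htail⟩ := hB.exists_Ioi_le_exp
  obtain ⟨s, hs, hφ⟩ := exists_lintegral_exp_stationaryExcess_lt hB.concentrated hBi hBm hc htail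
    ((one_lt_inv₀ hδ0).2 hstab)
  set φ := ∫⁻ x, ENNReal.ofReal (Real.exp (s * x)) ∂(stationaryExcess B)
  have hδφ : ENNReal.ofReal δ * φ < 1 := by
    calc ENNReal.ofReal δ * φ < ENNReal.ofReal δ * ENNReal.ofReal δ⁻¹ :=
          ENNReal.mul_lt_mul_right (by simpa using hδ0) (by simp) hφ
      _ = 1 := by rw [← ENNReal.ofReal_mul hδ0.le, mul_inv_cancel₀ hδ0.ne', ENNReal.ofReal_one]
  refine ⟨(1 - ENNReal.ofReal δ * φ)⁻¹, s, ?_, hs, fun ε h0 h1 x => ?_⟩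
  · simpa [tsub_eq_zero_iff_le] using hδφ
  have : IsProbabilityMeasure (mixtureClaim B (Measure.dirac 0) ε) :=
    isProbabilityMeasure_mixtureClaim h0 h1
  have : IsProbabilityMeasure (discardClaim B ε) := this
  have := isProbabilityMeasure_supLaw hlam
    (ae_isRegularPath_discardClaim hlam h0 h1 hB.concentrated hBi hBm hstab)
  have hrδ : (1 - ε) * δ ≤ δ := mul_le_of_le_one_left hδ0.le (by linarith)
  have hr0 : 0 ≤ (1 - ε) * δ := mul_nonneg (by linarith) hδ0.le
  have hbound := renewal_Ioi_le (A := 1) (c := φ) (x := x)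
    (g := ENNReal.ofReal (Real.exp (-s * x)))
    (by simpa using hr0) (by simpa using hrδ.trans_lt hstab)
    (supLaw_discardClaim_renewal hlam h0 h1 hB.concentrated hBi hBm hstab) (fun n => by
      rw [Measure.dirac_zero_conv, one_mul, ← lintegral_exp_convPow]
      exact measure_Ioi_le_exp_mul_lintegral _ hs.le x)
  rw [one_mul] at hbound
  refine hbound.trans ?_
  gcongr

/-- Uniformly in `ε`, the tail of the supremum without the `C`-claims is at most a multiple of any
subexponential tail. -/
lemma exists_supLaw_discardClaim_Ioi_le {F : Measure ℝ} (hF : IsSubexponential F) (hlam : 0 < lam)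
    (hB : IsPhaseType B) (hBi : Integrable (fun x : ℝ => x) B) (hBm : 0 < ∫ x, x ∂B)
    (hstab : lam * ∫ x, x ∂B < 1) :
    ∃ K : ℝ≥0∞, K ≠ ∞ ∧ 1 ≤ K ∧ ∀ ε : ℝ, 0 ≤ ε → ε ≤ 1 → ∀ x,
      supLaw lam (discardClaim B ε) (Set.Ioi x) ≤ K * F (Set.Ioi x) := by
  have := hF.isProbabilityMeasure
  have := hB.isProbabilityMeasure
  obtain ⟨K₀, s, hK₀, hs, hbound⟩ :=
    exists_supLaw_discardClaim_Ioi_le_exp hlam hB hBi hBm hstab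
  obtain ⟨A, hA, hexp⟩ := hF.exists_exp_le hs
  refine ⟨max 1 (K₀ * ENNReal.ofReal A), by finiteness, le_max_left _ _, fun ε h0 h1 x => ?_⟩
  rcases lt_or_ge x 0 with hx | hx
  · have : IsProbabilityMeasure (mixtureClaim B (Measure.dirac 0) ε) :=
      isProbabilityMeasure_mixtureClaim h0 h1
    have : IsProbabilityMeasure (discardClaim B ε) := this
    have := isProbabilityMeasure_supLaw hlam
      (ae_isRegularPath_discardClaim hlam h0 h1 hB.concentrated hBi hBm hstab)
    rw [measure_Ioi_of_neg hF.concentrated hx, mul_one]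
    exact prob_le_one.trans (le_max_left _ _)
  · calc _ ≤ K₀ * ENNReal.ofReal (Real.exp (-s * x)) := hbound ε h0 h1 x
      _ ≤ K₀ * ENNReal.ofReal (A * F.real (Set.Ioi x)) := by
        gcongr
        exact hexp x hx
      _ = K₀ * ENNReal.ofReal A * F (Set.Ioi x) := by
        rw [ENNReal.ofReal_mul hA.le, ofReal_measureReal, mul_assoc]
      _ ≤ _ := by
        gcongr
        exact le_max_right _ _

end

/-! ### Positivity of the ruin probability -/

lemma stationaryExcess_Iic_zero (G : Measure ℝ) : stationaryExcess G (Set.Iic 0) = 0 := by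
  refine withDensity_absolutelyContinuous _ _ ?_
  rw [Measure.restrict_apply measurableSet_Iic]
  rw [Set.inter_comm, Set.Ioi_inter_Iic, Set.Ioc_self, measure_empty]

/-- A renewal step of positive length `b` that is exceeded with positive probability can be iterated
to exceed every level. -/
lemma renewal_Ioi_pos {μ ν κ : Measure ℝ} [IsProbabilityMeasure μ] [IsProbabilityMeasure κ]
    {a r : ℝ≥0∞} (hμ : μ (Set.Iio 0) = 0) (hκ : κ (Set.Iic 0) = 0) (hr : r ≠ 0)
    (h : μ = a • ν + r • μ.conv κ) (u : ℝ) : μ (Set.Ioi u) ≠ 0 := by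
  obtain ⟨b, hb, hκb⟩ : ∃ b : ℝ, 0 < b ∧ κ (Set.Ioi b) ≠ 0 := by
    by_contra! hcon
    have h1 : κ (⋃ n : ℕ, Set.Ioi (1 / ((n : ℝ) + 1))) = 0 :=
      measure_iUnion_null fun n => hcon _ (by positivity)
    have h2 : Set.univ ⊆ Set.Iic 0 ∪ ⋃ n : ℕ, Set.Ioi (1 / ((n : ℝ) + 1)) := fun x _ => by
      rcases le_or_gt x 0 with hx | hx
      · exact Or.inl hx
      · obtain ⟨n, hn⟩ := exists_nat_one_div_lt hx
        exact Or.inr (Set.mem_iUnion.2 ⟨n, hn⟩)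
    have h3 : κ Set.univ = 0 := measure_mono_null h2 (measure_union_null hκ h1)
    simp at h3
  have hstep : ∀ x, μ (Set.Ioi x) ≠ 0 → μ (Set.Ioi (x + b)) ≠ 0 := by
    intro x hx h0
    rw [h, Measure.add_apply, Measure.smul_apply, Measure.smul_apply, smul_eq_mul, smul_eq_mul,
      add_eq_zero, mul_eq_zero (a := r), or_iff_right hr, conv_apply_Ioi] at h0
    have h1 : μ (Set.Ioi x) * κ (Set.Ioi b) ≤ ∫⁻ y, μ (Set.Ioi (x + b - y)) ∂κ := by
      rw [← lintegral_indicator_const measurableSet_Ioi]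
      refine lintegral_mono fun y => ?_
      by_cases hy : b < y
      · rw [Set.indicator_of_mem (by exact hy)]
        exact measure_mono (Set.Ioi_subset_Ioi (by linarith))
      · rw [Set.indicator_of_notMem (by exact hy)]
        exact zero_le
    rw [h0.2] at h1
    exact mul_ne_zero hx hκb (le_antisymm h1 zero_le)
  have hn : ∀ n : ℕ, μ (Set.Ioi (-1 + n * b)) ≠ 0 := fun n => by
    induction n with
    | zero => rw [measure_Ioi_of_neg hμ (by simp)]; exact one_ne_zero
    | succ n ih =>
      have := hstep _ ih
      push_cast
      rwa [add_one_mul, ← add_assoc]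
  obtain ⟨n, hnu⟩ := exists_nat_ge ((u + 1) / b)
  rw [div_le_iff₀ hb] at hnu
  exact fun h0 => hn n (measure_mono_null (Set.Ioi_subset_Ioi (by linarith)) h0)

/-! ### The relative error -/

/-- The error estimate at a fixed level. `T n` are the tails of the expansion, `W₂` and `W₃` the
tails of its remainders after two and three terms, so that
`ψ - ψ̂ = q² (T₂ - T₁) + q³ (W₃ - T₂)`, while `ψ ≥ q T₁`. -/
lemma relError_le {q T₀ T₁ T₂ W₁ W₂ W₃ ψ K : ℝ} (hq0 : 0 ≤ q) (hq1 : q ≤ 1) (hT₀ : 0 ≤ T₀)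
    (hT₁ : 0 < T₁) (hT : T₁ ≤ T₂) (hW₂ : T₁ ≤ W₂) (hW₃ : W₃ ≤ K * T₁) (hK : 0 ≤ K) (hψ : 0 < ψ)
    (e₁ : ψ = (1 - q) * T₀ + q * W₁) (e₂ : W₁ = (1 - q) * T₁ + q * W₂)
    (e₃ : W₂ = (1 - q) * T₂ + q * W₃) :
    1 - (T₀ + q * (T₁ - T₀)) / ψ ≤ q * (T₂ / T₁ - 1) + q ^ 2 * K := by
  have hψT : q * T₁ ≤ ψ := by
    have h1 : 0 ≤ (1 - q) * T₀ := mul_nonneg (by linarith) hT₀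
    have h2 := mul_le_mul_of_nonneg_left hW₂ (mul_nonneg hq0 hq0)
    rw [e₁, e₂]
    linarith
  have hR : 0 ≤ q * (T₂ / T₁ - 1) + q ^ 2 * K := by
    have : 1 ≤ T₂ / T₁ := (one_le_div hT₁).2 hT
    have : 0 ≤ q * (T₂ / T₁ - 1) := mul_nonneg hq0 (by linarith)
    positivity
  have hdiff : ψ - (T₀ + q * (T₁ - T₀)) ≤ (q * (T₂ / T₁ - 1) + q ^ 2 * K) * (q * T₁) := by
    have h1 : (q * (T₂ / T₁ - 1) + q ^ 2 * K) * (q * T₁) =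
        q ^ 2 * (T₂ - T₁) + q ^ 3 * (K * T₁) := by
      field_simp
    have h2 := mul_le_mul_of_nonneg_left hW₃ (pow_nonneg hq0 3)
    have h3 : 0 ≤ q ^ 3 * T₂ := mul_nonneg (pow_nonneg hq0 3) (by linarith)
    rw [h1, e₁, e₂, e₃]
    linarith
  have h := hdiff.trans (mul_le_mul_of_nonneg_left hψT hR)
  rw [one_sub_div hψ.ne', div_le_iff₀ hψ]
  exact h

lemma conv_convPow_real_renewal {μ ν κ : Measure ℝ} [IsProbabilityMeasure μ]
    [IsProbabilityMeasure ν] [IsProbabilityMeasure κ] {q : ℝ} (hq0 : 0 ≤ q) (hq1 : q ≤ 1)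
    (h : μ = ENNReal.ofReal (1 - q) • ν + ENNReal.ofReal q • μ.conv κ) (n : ℕ) (u : ℝ) :
    (μ.conv (convPow κ n)).real (Set.Ioi u) = (1 - q) * (ν.conv (convPow κ n)).real (Set.Ioi u) +
      q * (μ.conv (convPow κ (n + 1))).real (Set.Ioi u) := by
  rw [renewal_conv_convPow h n, Measure.real, Measure.add_apply, Measure.smul_apply,
    Measure.smul_apply, smul_eq_mul, smul_eq_mul, ENNReal.toReal_add (by finiteness)
      (by finiteness), ENNReal.toReal_mul, ENNReal.toReal_mul, ENNReal.toReal_ofReal (by linarith),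
    ENNReal.toReal_ofReal hq0]
  rfl

/-- The tails in the corrected approximation are the terms of the expansion: convolution is
commutative. -/
lemma discardTail_eq {lam ε : ℝ} {B C : Measure ℝ}
    [IsProbabilityMeasure (supLaw lam (discardClaim B ε))]
    [IsProbabilityMeasure (stationaryExcess C)] (n : ℕ) (u : ℝ) :
    discardTail lam B C ε n u = ((supLaw lam (discardClaim B ε)).conv
      (convPow ((stationaryExcess C).conv (supLaw lam (discardClaim B ε))) n)).real
        (Set.Ioi u) := by
  rw [discardTail]
  congr 1
  refine Measure.ext_of_charFun (funext fun t => ?_)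
  simp only [charFun_conv, charFun_convPow]
  ring

end RiskModel

open RiskModel in
theorem theoremt (lam : ℝ) (hlam : 0 < lam)
    (B C : Measure ℝ) (hB : RiskModel.IsPhaseType B)
    (hB_int : Integrable (fun x : ℝ => x) B) (hB_pos : 0 < ∫ x, x ∂B)
    (hC : IsProbabilityMeasure C) (hC_nonneg : C (Set.Iio 0) = 0)
    (hC_int : Integrable (fun x : ℝ => x) C)
    (hstable : lam * (∫ x, x ∂B) < 1)
    (hCe : RiskModel.IsSubexponential (RiskModel.stationaryExcess C)) :
    ∃ η : ℝ, 0 < η ∧ ∃ K : ℝ, ∀ ε : ℝ, 0 ≤ ε → ε ≤ 1 → ε < η → ∀ u : ℝ, 0 ≤ u →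
      RiskModel.discardRelError lam B C ε u ≤
        RiskModel.discardCoeff lam B C ε * RiskModel.discardH lam B C ε u + ε ^ 2 * K := by
  have := hB.isProbabilityMeasure
  have := hCe.isProbabilityMeasure
  have hBe := isProbabilityMeasure_stationaryExcess hB.concentrated hB_int hB_pos
  set F := stationaryExcess C with hFdef
  set δ := lam * ∫ x, x ∂B with hδ
  set θ := lam * ∫ x, x ∂C with hθ
  have hδ0 : 0 < δ := by positivity
  -- If `E C = 0`, the density of the stationary excess distribution is `x / 0 = 0`.
  have hCm : 0 < ∫ x, x ∂C := by
    refine (integral_nonneg_of_ae (ae_nonneg_of_Iio_zero hC_nonneg)).lt_of_ne' fun h0 => ?_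
    have h1 : F Set.univ = 0 := by simp [hFdef, stationaryExcess, h0]
    simp at h1
  have hθ0 : 0 < θ := by positivity
  obtain ⟨S, hS, hS1, hSconv⟩ := hCe.exists_conv_Ioi_le
  obtain ⟨K, hK, hK1, hν⟩ :=
    exists_supLaw_discardClaim_Ioi_le hCe hlam hB hB_int hB_pos hstable
  set c : ℝ≥0∞ := K * S * S with hc
  have hctop : c ≠ ∞ := by finiteness
  have hc1 : 1 ≤ c := one_le_mul (one_le_mul hK1 hS1) hS1
  have hcR : 1 ≤ c.toReal := by simpa using ENNReal.toReal_mono hctop hc1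
  set K' : ℝ≥0∞ := 2 * K * c ^ 3 with hK'
  have hK'top : K' ≠ ∞ := by finiteness
  have hδ1 : 0 < 1 - δ := by linarith
  refine ⟨min 1 ((1 - δ) / (2 * θ * c.toReal)), lt_min one_pos (by positivity),
    (θ / (1 - δ)) ^ 2 * K'.toReal, fun ε h0 h1 hε u hu => ?_⟩
  have hε1 : ε < 1 := hε.trans_le (min_le_left _ _)
  have hε2 : ε < (1 - δ) / (2 * θ * c.toReal) := hε.trans_le (min_le_right _ _)
  set q := discardCoeff lam B C ε with hqdef
  have hqeq : q = ε * θ / (1 - δ + ε * δ) := rfl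
  have hεδ : 0 ≤ ε * δ := by positivity
  have hq0 : 0 ≤ q := by rw [hqeq]; positivity
  have hqle : q ≤ ε * (θ / (1 - δ)) := by
    rw [hqeq, mul_div_assoc]
    gcongr
    linarith
  -- The choice of `η` makes the geometric series with ratio `q c` converge.
  have hqc : q * c.toReal ≤ 1 / 2 := by
    rw [lt_div_iff₀ (by positivity)] at hε2
    calc q * c.toReal ≤ ε * (θ / (1 - δ)) * c.toReal := by gcongr
      _ = ε * (2 * θ * c.toReal) / (1 - δ) / 2 := by field_simp
      _ ≤ 1 / 2 := by
        gcongr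
        rw [div_le_one hδ1]
        exact hε2.le
  have hq1 : q < 1 := by
    have : q * 1 ≤ q * c.toReal := by gcongr
    linarith
  have hreg := ae_isRegularPath_discardClaim hlam h0 h1 hB.concentrated hB_int hB_pos hstable
  have hstab' : (1 - ε) * δ + ε * θ < 1 := by
    rw [hqeq, div_lt_one (by linarith)] at hq1
    linarith
  have hreg' := ae_isRegularPath_mixtureClaim hlam h0 h1 hB.concentrated hC_nonneg hB_int hC_int
    hstab'
  have : IsProbabilityMeasure (mixtureClaim B (Measure.dirac 0) ε) :=
    isProbabilityMeasure_mixtureClaim h0 h1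
  have : IsProbabilityMeasure (discardClaim B ε) := this
  have : IsProbabilityMeasure (mixtureClaim B C ε) := isProbabilityMeasure_mixtureClaim h0 h1
  have := isProbabilityMeasure_supLaw hlam hreg
  have := isProbabilityMeasure_supLaw hlam hreg'
  have hren := supLaw_mixtureClaim_renewal hlam h0 h1 hB.concentrated hC_nonneg hB_int hC_int
    hB_pos hCm hstable hq1
  have hν0 := supLaw_Iio_zero hreg
  have hμ0 := supLaw_Iio_zero hreg'
  have hpos : supLaw lam (discardClaim B ε) (Set.Ioi u) ≠ 0 :=
    renewal_Ioi_pos hν0 (stationaryExcess_Iic_zero B)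
      (by simpa using mul_pos (sub_pos.2 hε1) hδ0)
      (supLaw_discardClaim_renewal hlam h0 h1 hB.concentrated hB_int hB_pos hstable) u
  have hruin := ruinProb_eq_supLaw hreg u
  have hruin' := ruinProb_eq_supLaw hreg' u
  have htail : ∀ n, discardTail lam B C ε n u = _ := fun n => discardTail_eq n u
  rw [← hFdef] at hren
  rw [discardRelError, discardH, correctedDiscard, hruin, hruin', htail 1, htail 2, ← hqdef,
    ← hFdef]
  have hνε := hν ε h0 h1
  generalize supLaw lam (discardClaim B ε) = ν at *
  generalize supLaw lam (mixtureClaim B C ε) = μ at *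
  set κ := F.conv ν with hκdef
  have hκ0 : κ (Set.Iio 0) = 0 := conv_Iio_zero hCe.concentrated hν0
  have hκ : ∀ x, κ (Set.Ioi x) ≤ K * S * F (Set.Ioi x) := fun x => by
    simpa using conv_Ioi_le_of_le hSconv (fun x => (one_mul (F (Set.Ioi x))).ge) hνε x
  have hμ : ∀ x, μ (Set.Ioi x) ≤ 2 * K * F (Set.Ioi x) := fun x => by
    have hqc' : ENNReal.ofReal q * c ≤ 2⁻¹ := by
      rw [← ENNReal.ofReal_toReal hctop, ← ENNReal.ofReal_mul hq0,
        ENNReal.ofReal_le_iff_le_toReal (by simp)]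
      simpa using hqc
    refine (renewal_Ioi_le (by simpa using hq0) (by simpa using hq1) hren
      fun n => conv_convPow_Ioi_le_of_le hSconv hνε hκ n x).trans ?_
    rw [mul_comm 2 K]
    gcongr
    rw [← inv_inv (2 : ℝ≥0∞)]
    refine ENNReal.inv_le_inv.2 ?_
    rw [← ENNReal.one_sub_inv_two]
    exact tsub_le_tsub_left hqc' 1
  have hone : ∀ ρ : Measure ℝ, convPow ρ 0 = Measure.dirac 0 := fun _ => rfl
  have e₁ := conv_convPow_real_renewal hq0 hq1.le hren 0 u
  have e₂ := conv_convPow_real_renewal hq0 hq1.le hren 1 u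
  have e₃ := conv_convPow_real_renewal hq0 hq1.le hren 2 u
  rw [hone, Measure.conv_dirac_zero, Measure.conv_dirac_zero] at e₁
  -- The measures below are convolutions of the same factors, so their characteristic functions
  -- agree; a nonnegative extra summand only increases a tail.
  have hFT : F.real (Set.Ioi u) ≤ (ν.conv (convPow κ 1)).real (Set.Ioi u) := by
    have h : ν.conv (convPow κ 1) = F.conv (ν.conv ν) := by
      refine Measure.ext_of_charFun (funext fun t => ?_)
      simp only [hκdef, charFun_conv, charFun_convPow]
      ring
    rw [h]
    exact ENNReal.toReal_mono (by finiteness) (Ioi_le_conv (conv_Iio_zero hν0 hν0) u)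
  have hT : (ν.conv (convPow κ 1)).real (Set.Ioi u) ≤ (ν.conv (convPow κ 2)).real (Set.Ioi u) := by
    rw [convPow.eq_2 κ 1, ← Measure.conv_assoc]
    exact ENNReal.toReal_mono (by finiteness) (Ioi_le_conv hκ0 u)
  have hW₂ : (ν.conv (convPow κ 1)).real (Set.Ioi u) ≤ (μ.conv (convPow κ 2)).real (Set.Ioi u) := by
    have h : μ.conv (convPow κ 2) = (ν.conv (convPow κ 1)).conv (μ.conv F) := by
      refine Measure.ext_of_charFun (funext fun t => ?_)
      simp only [hκdef, charFun_conv, charFun_convPow]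
      ring
    rw [h]
    exact ENNReal.toReal_mono (by finiteness) (Ioi_le_conv (conv_Iio_zero hμ0 hCe.concentrated) u)
  have hW₃ : (μ.conv (convPow κ 3)).real (Set.Ioi u) ≤
      K'.toReal * (ν.conv (convPow κ 1)).real (Set.Ioi u) := by
    have h := ENNReal.toReal_mono (by finiteness) (conv_convPow_Ioi_le_of_le hSconv hμ hκ 3 u)
    rw [ENNReal.toReal_mul] at h
    exact h.trans (mul_le_mul_of_nonneg_left hFT ENNReal.toReal_nonneg)
  have hν_pos : 0 < ν.real (Set.Ioi u) := ENNReal.toReal_pos hpos (by finiteness)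
  have hψ : 0 < μ.real (Set.Ioi u) := by
    rw [e₁]
    have := mul_pos (sub_pos.2 hq1) hν_pos
    positivity
  have hmain := relError_le hq0 hq1.le hν_pos.le ((hCe.real_Ioi_pos u).trans_le hFT) hT hW₂ hW₃
    ENNReal.toReal_nonneg hψ e₁ e₂ e₃
  refine hmain.trans (add_le_add_right ?_ _)
  calc q ^ 2 * K'.toReal ≤ (ε * (θ / (1 - δ))) ^ 2 * K'.toReal := by gcongr
    _ = ε ^ 2 * ((θ / (1 - δ)) ^ 2 * K'.toReal) := by ring
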